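/- Let $N\ge 2$, let $\Omega\subset\mathbb{R}^N$ be a bounded domain (nonempty, open, connected) with smooth boundary and unit outer normal $\mathbf n$, let $1<q<2<p<\infty$, and let $a,b\in C^{\alpha}(\overline\Omega)$ for some $\alpha\in(0,1)$ with $a\not\equiv 0$, $b\not\equiv 0$ and $b\ge 0$. For $\lambda\in\mathbb{R}$ consider the problem $$-\Delta u=\lambda b(x)u^{q-1}+a(x)u^{p-1}\ \text{ in }\Omega,\qquad \frac{\partial u}{\partial\mathbf n}=0\ \text{ on }\partial\Omega. \tag{$P_\lambda$}$$ A nonnegative solution of $(P_\lambda)$ is a function $u\ge 0$ on $\overline\Omega$, with $u\in C^{2+\theta}(\overline\Omega)$ for some $\theta\in(0,1)$, that satisfies $(P_\lambda)$ in the classical sense. It is nontrivial if $u\not\equiv 0$, and it is called a positive solution if $u>0$ on $\overline\Omega$. Assume that $\int_\Omega a\ge 0$. Then: 1. For every $\lambda\ge 0$, $(P_\lambda)$ has no positive solution. 2. Assume moreover that $p\le \frac{2N}{N-2}$ if $N>2$. Then for every $\Lambda>0$ there exists $\delta_0>0$ such that $\max_{\overline\Omega}u>\delta_0$ for every $\lambda\le-\Lambda$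 and every nontrivial nonnegative solution $u$ of $(P_\lambda)$. -/

import Mathlib

open Set Filter Topology MeasureTheory
open scoped NNReal ContDiff Gradient InnerProductSpace

/-- `ρ` is a smooth defining function of `Ω` near the boundary point `x`: on the open
neighbourhood `U` of `x` the set `Ω` is `{ρ < 0}`, and `∇ρ(x) ≠ 0`. -/
structure IsLocalDefiningFunction {N : ℕ} (Ω : Set (EuclideanSpace ℝ (Fin N)))
    (x : EuclideanSpace ℝ (Fin N)) (U : Set (EuclideanSpace ℝ (Fin N)))
    (ρ : EuclideanSpace ℝ (Fin N) → ℝ) : Prop where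
  isOpen : IsOpen U
  mem : x ∈ U
  contDiffOn : ContDiffOn ℝ ∞ ρ U
  inter_eq : Ω ∩ U = {y | y ∈ U ∧ ρ y < 0}
  gradient_ne_zero : ∇ ρ x ≠ 0

/-- A bounded domain (nonempty connected open set) of `ℝ^N` with `C^∞` boundary. -/
structure IsSmoothBoundedDomain {N : ℕ} (Ω : Set (EuclideanSpace ℝ (Fin N))) : Prop where
  isOpen : IsOpen Ω
  isConnected : IsConnected Ω
  isBounded : Bornology.IsBounded Ω
  smooth_boundary : ∀ x ∈ frontier Ω, ∃ U ρ, IsLocalDefiningFunction Ω x U ρ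

/-- `ν` is the unit outer normal of `Ω` at the boundary point `x`, that is
`ν = ∇ρ(x) / |∇ρ(x)|` for a local defining function `ρ` (negative inside `Ω`).
At a boundary point of a smooth domain there is exactly one such `ν`. -/
def IsOuterUnitNormal {N : ℕ} (Ω : Set (EuclideanSpace ℝ (Fin N)))
    (x ν : EuclideanSpace ℝ (Fin N)) : Prop :=
  ∃ U ρ, IsLocalDefiningFunction Ω x U ρ ∧ ν = ‖∇ ρ x‖⁻¹ • ∇ ρ x

/-- The Hölder space `C^α(closure Ω)`. Functions on `closure Ω` are represented by functions on
the whole space, of which only the values on `closure Ω` matter. -/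
def MemHolderClosure {N : ℕ} (Ω : Set (EuclideanSpace ℝ (Fin N))) (α : ℝ≥0)
    (f : EuclideanSpace ℝ (Fin N) → ℝ) : Prop :=
  ∃ C : ℝ≥0, HolderOnWith C α f (closure Ω)

/-- The space `C^{2+θ}(closure Ω)`: `u` is `C^2` in `Ω`, `u` and `∇u` are continuous up to the
boundary, and the second derivatives are uniformly `θ`-Hölder continuous in `Ω` (so that they
extend to `closure Ω` with the same property). -/
structure MemC2Holder {N : ℕ} (Ω : Set (EuclideanSpace ℝ (Fin N))) (θ : ℝ≥0)
    (u : EuclideanSpace ℝ (Fin N) → ℝ) : Prop where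
  contDiffOn : ContDiffOn ℝ 2 u Ω
  continuousOn : ContinuousOn u (closure Ω)
  gradient_extends : ∃ g : EuclideanSpace ℝ (Fin N) → EuclideanSpace ℝ (Fin N),
    ContinuousOn g (closure Ω) ∧ EqOn g (∇ u) Ω
  holder : ∃ C : ℝ≥0, HolderOnWith C θ (iteratedFDeriv ℝ 2 u) Ω

/-- The derivative of `u` in the direction `ν` at a boundary point `x` of `Ω`: the scalar product
with `ν` of the continuous extension of `∇u` from `Ω` to `x`. -/
noncomputable def boundaryDeriv {N : ℕ} (Ω : Set (EuclideanSpace ℝ (Fin N)))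
    (u : EuclideanSpace ℝ (Fin N) → ℝ) (x ν : EuclideanSpace ℝ (Fin N)) : ℝ :=
  inner ℝ (extendFrom Ω (∇ u) x) ν

/-- `u` is a nonnegative classical solution of
`-Δu = lam b u^(q-1) + a u^(p-1)` in `Ω`, `∂u/∂n = 0` on `∂Ω`. -/
structure IsNonnegSolution {N : ℕ} (Ω : Set (EuclideanSpace ℝ (Fin N)))
    (a b : EuclideanSpace ℝ (Fin N) → ℝ) (p q lam : ℝ)
    (u : EuclideanSpace ℝ (Fin N) → ℝ) : Prop where
  regular : ∃ θ : ℝ≥0, 0 < θ ∧ θ < 1 ∧ MemC2Holder Ω θ u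
  nonneg : ∀ x ∈ closure Ω, 0 ≤ u x
  equation : ∀ x ∈ Ω,
    -(Laplacian.laplacian u x) = lam * b x * u x ^ (q - 1) + a x * u x ^ (p - 1)
  neumann : ∀ x ∈ frontier Ω, ∀ ν, IsOuterUnitNormal Ω x ν → boundaryDeriv Ω u x ν = 0

/-- A nonnegative solution that does not vanish identically. -/
def IsNontrivialNonnegSolution {N : ℕ} (Ω : Set (EuclideanSpace ℝ (Fin N)))
    (a b : EuclideanSpace ℝ (Fin N) → ℝ) (p q lam : ℝ)
    (u : EuclideanSpace ℝ (Fin N) → ℝ) : Prop :=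
  IsNonnegSolution Ω a b p q lam u ∧ ∃ x ∈ closure Ω, u x ≠ 0

/-- A solution that is positive on `closure Ω`. -/
def IsPositiveSolution {N : ℕ} (Ω : Set (EuclideanSpace ℝ (Fin N)))
    (a b : EuclideanSpace ℝ (Fin N) → ℝ) (p q lam : ℝ)
    (u : EuclideanSpace ℝ (Fin N) → ℝ) : Prop :=
  IsNonnegSolution Ω a b p q lam u ∧ ∀ x ∈ closure Ω, 0 < u x

/-! Both claims follow from testing the equation with a function of `u`. Integrating the divergence
of `φ(u) ∇u` and using the Neumann condition gives `∫ φ'(u) |∇u|² = ∫ φ(u) (lam b u^(q-1) + a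
u^(p-1))` (`IsNonnegSolution.integral_energy_eq_zero`).

For a positive solution take `φ(s) = s^(1-p)`. Then `(1-p) ∫ u^(-p) |∇u|² = lam ∫ b u^(q-p) + ∫ a`,
with left side nonpositive and right side nonnegative. So `∇u = 0`, and the equation or the identity
itself forces `a = 0` or `b = 0` in `Ω`.

For the lower bound take `φ(s) = s`. If `u ≤ δ ≤ 1`, then `u² ≤ u^q` because `q < 2`, and `u^p ≤
δ^(p-2) u²`, so `∫ |∇u|² + Lam ∫ b u² ≤ A δ^(p-2) ∫ u²`, where `A` bounds `a` from above. A Poincaré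
inequality with weight `b` bounds `∫ u²` by a multiple of the left side, so `u = 0` once `δ` is
small.

Two tools carry most of the work. The divergence theorem for fields tangential at the boundary is
proved without surface measure, by cutting off with a function of a local defining function
(`integral_localized_divergence_eq_zero`). The Poincaré inequality is proved without compactness of
embeddings: control of `∫ u²` spreads by translation from a ball where `b > 0` to all of `Ω`
(`massControlled_ball_of_mem`, `massControlled_ball_of_mem_frontier`). -/

/-- The divergence of a vector field on `ℝ^N`. -/
noncomputable def divergence {N : ℕ} (G : EuclideanSpace ℝ (Fin N) → EuclideanSpace ℝ (Fin N))
    (x : EuclideanSpace ℝ (Fin N)) : ℝ :=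
  ∑ i, (fderiv ℝ G x (EuclideanSpace.single i 1)) i

/-! ### Divergence of compactly supported fields. -/

section Divergence

variable {N : ℕ} {G : EuclideanSpace ℝ (Fin N) → EuclideanSpace ℝ (Fin N)}

theorem divergence_congr {F : EuclideanSpace ℝ (Fin N) → EuclideanSpace ℝ (Fin N)}
    {x : EuclideanSpace ℝ (Fin N)} (h : F =ᶠ[𝓝 x] G) : divergence F x = divergence G x := by
  simp only [divergence, h.fderiv_eq]

/-- Integration by parts against the constant `1`, one coordinate at a time. -/
theorem integral_divergence_eq_zero (hG : ContDiff ℝ 1 G) (hc : HasCompactSupport G) :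
    ∫ x, divergence G x = 0 := by
  have hcoord : ∀ i : Fin N, ∀ x, (fderiv ℝ G x (EuclideanSpace.single i 1)) i =
      fderiv ℝ (fun y => G y i) x (EuclideanSpace.single i 1) := by
    intro i x
    have h1 : HasFDerivAt (fun y => G y i)
        ((EuclideanSpace.proj i : EuclideanSpace ℝ (Fin N) →L[ℝ] ℝ).comp (fderiv ℝ G x)) x :=
      (EuclideanSpace.proj i : EuclideanSpace ℝ (Fin N) →L[ℝ] ℝ).hasFDerivAt.comp x
        (hG.differentiable one_ne_zero x).hasFDerivAt
    rw [h1.fderiv]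
    rfl
  have hcd : ∀ i : Fin N, ContDiff ℝ 1 (fun y => G y i) := fun i =>
    (EuclideanSpace.proj i : EuclideanSpace ℝ (Fin N) →L[ℝ] ℝ).contDiff.comp hG
  have hcs : ∀ i : Fin N, HasCompactSupport (fun y => G y i) := fun i =>
    hc.comp_left (g := fun v : EuclideanSpace ℝ (Fin N) => v i) rfl
  have hint : ∀ i : Fin N, Integrable
      (fun x => fderiv ℝ (fun y => G y i) x (EuclideanSpace.single i 1)) := fun i =>
    (((hcd i).continuous_fderiv one_ne_zero).clm_apply continuous_const).integrable_of_hasCompactSupport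
      ((hcs i).fderiv_apply ℝ _)
  simp only [divergence, hcoord]
  rw [integral_finsetSum _ fun i _ => hint i]
  refine Finset.sum_eq_zero fun i _ => ?_
  have := integral_mul_fderiv_eq_neg_fderiv_mul_of_integrable (𝕜 := ℝ) (μ := volume)
    (f := fun _ : EuclideanSpace ℝ (Fin N) => (1 : ℝ)) (g := fun y => G y i)
    (v := EuclideanSpace.single i 1) (by simp) (by simpa using hint i)
    (by simpa using (hcd i).continuous.integrable_of_hasCompactSupport (hcs i))
    (by fun_prop) (fun x _ => (hcd i).differentiable one_ne_zero x)
  simpa using this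

theorem divergence_smul {ζ : EuclideanSpace ℝ (Fin N) → ℝ} {x : EuclideanSpace ℝ (Fin N)}
    (hζ : DifferentiableAt ℝ ζ x) (hG : DifferentiableAt ℝ G x) :
    divergence (fun y => ζ y • G y) x = ζ x * divergence G x + fderiv ℝ ζ x (G x) := by
  have h := (hζ.hasFDerivAt.smul hG.hasFDerivAt).fderiv
  have hsum : G x = ∑ i, (G x i) • EuclideanSpace.single i (1 : ℝ) := by
    ext j
    simp [Finset.sum_apply, Pi.single_apply]
  simp only [divergence]
  conv_rhs => rw [hsum]
  change ∑ i, (fderiv ℝ (ζ • G) x _) i = _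
  simp only [h, map_sum, map_smul, Finset.mul_sum, ← Finset.sum_add_distrib]
  refine Finset.sum_congr rfl fun i _ => ?_
  simp [mul_comm]

theorem divergence_sum {ι : Type*} {s : Finset ι}
    {F : ι → EuclideanSpace ℝ (Fin N) → EuclideanSpace ℝ (Fin N)} {x : EuclideanSpace ℝ (Fin N)}
    (hF : ∀ j ∈ s, DifferentiableAt ℝ (F j) x) :
    divergence (fun y => ∑ j ∈ s, F j y) x = ∑ j ∈ s, divergence (F j) x := by
  simp only [divergence, fderiv_fun_sum hF]
  rw [Finset.sum_comm]
  refine Finset.sum_congr rfl fun i _ => ?_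
  simp

/-- The divergence theorem for the product of a vector field with a function that is supported in
a compact subset of the open set where the field is `C^1`. -/
theorem setIntegral_cutoff_eq_zero {V S K : Set (EuclideanSpace ℝ (Fin N))} (hV : IsOpen V)
    (hG : ContDiffOn ℝ 1 G V) {ζ : EuclideanSpace ℝ (Fin N) → ℝ} (hζ : ContDiff ℝ 1 ζ)
    (hK : IsCompact K) (hKV : K ⊆ V) (hKS : K ⊆ S) (h0 : ∀ x, x ∉ K → ζ x = 0) :
    ∫ x in S, (ζ x * divergence G x + fderiv ℝ ζ x (G x)) = 0 := by
  have hev : ∀ x, x ∉ K → ζ =ᶠ[𝓝 x] fun _ => 0 := fun x hx => by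
    filter_upwards [hK.isClosed.isOpen_compl.mem_nhds hx] with y hy using h0 y hy
  have hevG : ∀ x, x ∉ K → (fun y => ζ y • G y) =ᶠ[𝓝 x] fun _ => 0 := fun x hx => by
    filter_upwards [hev x hx] with y hy
    simp [hy]
  have hzero : ∀ x, x ∉ K → ζ x * divergence G x + fderiv ℝ ζ x (G x) = 0 := fun x hx => by
    rw [h0 x hx, (hev x hx).fderiv_eq]
    simp
  rw [setIntegral_eq_integral_of_forall_compl_eq_zero
    fun x hx => hzero x fun hxK => hx (hKS hxK)]
  -- `G` may be irregular off `V`, but every point outside the closed set `K` has a neighbourhood on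
  -- which the product is zero.
  have hcd : ContDiff ℝ 1 fun y => ζ y • G y := by
    rw [contDiff_iff_contDiffAt]
    intro x
    by_cases hx : x ∈ K
    · exact hζ.contDiffAt.smul (hG.contDiffAt (hV.mem_nhds (hKV hx)))
    · exact contDiffAt_const.congr_of_eventuallyEq (hevG x hx)
  have hcs : HasCompactSupport fun y => ζ y • G y :=
    HasCompactSupport.intro hK fun x hx => by simp [h0 x hx]
  rw [← integral_divergence_eq_zero hcd hcs]
  refine integral_congr_ae (Eventually.of_forall fun x => ?_)
  by_cases hx : x ∈ K
  · exact (divergence_smul (hζ.differentiable one_ne_zero x)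
      ((hG.contDiffAt (hV.mem_nhds (hKV hx))).differentiableAt one_ne_zero)).symm
  · simp only [hzero x hx]
    rw [divergence_congr (hevG x hx)]
    simp [divergence]

end Divergence

/-! ### Local defining functions at the boundary. -/

section BoundaryChart

variable {N : ℕ} {Ω U : Set (EuclideanSpace ℝ (Fin N))} {x : EuclideanSpace ℝ (Fin N)}
  {ρ : EuclideanSpace ℝ (Fin N) → ℝ}

theorem IsLocalDefiningFunction.nonpos_of_mem_closure (h : IsLocalDefiningFunction Ω x U ρ)
    {y : EuclideanSpace ℝ (Fin N)} (hy : y ∈ U) (hyc : y ∈ closure Ω) : ρ y ≤ 0 := by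
  have hc : ContinuousAt ρ y := h.contDiffOn.continuousOn.continuousAt (h.isOpen.mem_nhds hy)
  by_contra! hpos
  obtain ⟨z, ⟨hz0, hzU⟩, hzΩ⟩ := mem_closure_iff_nhds.1 hyc _
    (inter_mem (hc.eventually (lt_mem_nhds hpos)) (h.isOpen.mem_nhds hy))
  have : z ∈ {y | y ∈ U ∧ ρ y < 0} := h.inter_eq ▸ ⟨hzΩ, hzU⟩
  exact absurd this.2 (not_lt.2 (le_of_lt hz0))

theorem IsLocalDefiningFunction.mem_iff (h : IsLocalDefiningFunction Ω x U ρ)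
    {y : EuclideanSpace ℝ (Fin N)} (hy : y ∈ U) : y ∈ Ω ↔ ρ y < 0 := by
  have : y ∈ Ω ∩ U ↔ y ∈ {y | y ∈ U ∧ ρ y < 0} := by rw [h.inter_eq]
  simpa [hy] using this

/-- Near a boundary point there is a defining function that serves all points of a ball and
increases at a uniform rate in a fixed direction. -/
theorem IsSmoothBoundedDomain.exists_boundary_chart (hΩ : IsSmoothBoundedDomain Ω)
    (hx : x ∈ frontier Ω) :
    ∃ (R : ℝ) (ρ : EuclideanSpace ℝ (Fin N) → ℝ) (n : EuclideanSpace ℝ (Fin N)) (c : ℝ),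
      0 < R ∧ 0 < c ∧
      (∀ y ∈ Metric.ball x R, IsLocalDefiningFunction Ω y (Metric.ball x R) ρ) ∧
      ∀ y ∈ Metric.ball x R, c ≤ fderiv ℝ ρ y n := by
  obtain ⟨U, ρ, h⟩ := hΩ.smooth_boundary x hx
  -- At `x` the derivative of `ρ` along its own gradient is `‖n‖² > 0`. By continuity it exceeds
  -- half of that on a ball, so the gradient does not vanish there and `ρ` is a defining function at
  -- every point of the ball.
  set n := ∇ ρ x with hn
  have hnx : fderiv ℝ ρ x n = ‖n‖ ^ 2 := by
    rw [← inner_gradient_left (𝕜 := ℝ), ← hn, real_inner_self_eq_norm_sq]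
  have hn0 : 0 < ‖n‖ ^ 2 := by
    have := norm_pos_iff.2 h.gradient_ne_zero
    positivity
  have hcont : ContinuousAt (fun y => fderiv ℝ ρ y n) x :=
    ((h.contDiffOn.continuousOn_fderiv_of_isOpen h.isOpen (by simp)).continuousAt
      (h.isOpen.mem_nhds h.mem)).clm_apply continuousAt_const
  have hev : ∀ᶠ y in 𝓝 x, ‖n‖ ^ 2 / 2 < fderiv ℝ ρ y n :=
    hcont.eventually (lt_mem_nhds (by simp only [hnx]; linarith))
  obtain ⟨R, hR, hball⟩ := Metric.mem_nhds_iff.1 (inter_mem hev (h.isOpen.mem_nhds h.mem))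
  refine ⟨R, ρ, n, ‖n‖ ^ 2 / 2, hR, by linarith, fun y hy => ⟨Metric.isOpen_ball, hy,
    h.contDiffOn.mono fun z hz => (hball hz).2, ?_, ?_⟩, fun y hy => (hball hy).1.le⟩
  · ext z
    simp only [mem_inter_iff, mem_ofPred_eq]
    constructor
    · exact fun hz => ⟨hz.2, (h.mem_iff (hball hz.2).2).1 hz.1⟩
    · exact fun hz => ⟨(h.mem_iff (hball hz.1).2).2 hz.2, hz.1⟩
  · intro h0
    have h1 : ‖n‖ ^ 2 / 2 < fderiv ℝ ρ y n := (hball hy).1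
    rw [← inner_gradient_left (𝕜 := ℝ), h0, inner_zero_left] at h1
    linarith

end BoundaryChart

/-! ### The cutoff in the depth variable. -/

/-- A smooth nonincreasing function that is `1` on `(-∞, -2ε]` and `0` on `[-ε, ∞)`. -/
noncomputable def boundaryCutoff (ε t : ℝ) : ℝ := Real.smoothTransition (-t / ε - 1)

section BoundaryCutoff

variable {ε t : ℝ}

theorem contDiff_boundaryCutoff {n : ℕ∞} : ContDiff ℝ n (boundaryCutoff ε) :=
  Real.smoothTransition.contDiff.comp (by fun_prop)

theorem boundaryCutoff_nonneg : 0 ≤ boundaryCutoff ε t := Real.smoothTransition.nonneg _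

theorem boundaryCutoff_le_one : boundaryCutoff ε t ≤ 1 := Real.smoothTransition.le_one _

theorem boundaryCutoff_eq_zero (hε : 0 < ε) (ht : -ε ≤ t) : boundaryCutoff ε t = 0 := by
  refine Real.smoothTransition.zero_of_nonpos ?_
  rw [sub_nonpos, div_le_one hε]
  linarith

theorem boundaryCutoff_eq_one (hε : 0 < ε) (ht : t ≤ -2 * ε) : boundaryCutoff ε t = 1 := by
  refine Real.smoothTransition.one_of_one_le ?_
  have : 2 ≤ -t / ε := by
    rw [le_div_iff₀ hε]
    linarith
  linarith

theorem deriv_boundaryCutoff_nonpos (hε : 0 < ε) : deriv (boundaryCutoff ε) t ≤ 0 := by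
  have : Antitone (boundaryCutoff ε) := fun s t hst => by
    refine Real.smoothTransition.monotone ?_
    gcongr
  exact this.deriv_nonpos

theorem deriv_boundaryCutoff_eq_zero_of_gt (hε : 0 < ε) (ht : -ε < t) :
    deriv (boundaryCutoff ε) t = 0 := by
  have : boundaryCutoff ε =ᶠ[𝓝 t] fun _ => 0 := by
    filter_upwards [lt_mem_nhds ht] with s hs using boundaryCutoff_eq_zero hε hs.le
  rw [this.deriv_eq, deriv_const]

theorem deriv_boundaryCutoff_eq_zero_of_lt (hε : 0 < ε) (ht : t < -2 * ε) :
    deriv (boundaryCutoff ε) t = 0 := by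
  have : boundaryCutoff ε =ᶠ[𝓝 t] fun _ => 1 := by
    filter_upwards [gt_mem_nhds ht] with s hs using boundaryCutoff_eq_one hε hs.le
  rw [this.deriv_eq, deriv_const]

end BoundaryCutoff

/-! ### The divergence theorem in a boundary chart. -/

section LocalDivergence

variable {N : ℕ} {Ω B : Set (EuclideanSpace ℝ (Fin N))} {x₀ : EuclideanSpace ℝ (Fin N)}
  {ρ ψ : EuclideanSpace ℝ (Fin N) → ℝ} {G : EuclideanSpace ℝ (Fin N) → EuclideanSpace ℝ (Fin N)}
  {ε : ℝ}

/-- The points of the support of `ψ` that lie in `Ω` at depth at least `ε`. -/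
theorem isCompact_inner_support (h : IsLocalDefiningFunction Ω x₀ B ρ) (hψc : HasCompactSupport ψ)
    (hψB : tsupport ψ ⊆ B) : IsCompact (tsupport ψ ∩ {x | ρ x ≤ -ε}) := by
  refine hψc.isCompact.of_isClosed_subset ?_ inter_subset_left
  exact (h.contDiffOn.continuousOn.mono hψB).preimage_isClosed_of_isClosed (isClosed_tsupport ψ)
    isClosed_Iic

theorem inner_support_subset (h : IsLocalDefiningFunction Ω x₀ B ρ) (hψB : tsupport ψ ⊆ B)
    (hε : 0 < ε) : tsupport ψ ∩ {x | ρ x ≤ -ε} ⊆ Ω ∩ B := fun x hx =>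
  ⟨(h.mem_iff (hψB hx.1)).2 (lt_of_le_of_lt hx.2 (by linarith)), hψB hx.1⟩

/-- A function on `Ω ∩ B` which has `ψ η_ε'(ρ)` as a factor is integrable. -/
theorem integrableOn_boundaryLayer (h : IsLocalDefiningFunction Ω x₀ B ρ) (hΩ : IsOpen Ω)
    (hψ : Continuous ψ)
    (hψc : HasCompactSupport ψ) (hψB : tsupport ψ ⊆ B) (hε : 0 < ε)
    {g : EuclideanSpace ℝ (Fin N) → ℝ} (hg : ContinuousOn g (Ω ∩ B)) :
    IntegrableOn (fun x => -(ψ x * deriv (boundaryCutoff ε) (ρ x)) * g x) (Ω ∩ B) := by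
  have hK := isCompact_inner_support (ε := ε) h hψc hψB
  have hKV := inner_support_subset h hψB hε
  have hd : Continuous (deriv (boundaryCutoff ε)) :=
    (contDiff_boundaryCutoff (n := 1)).continuous_deriv le_rfl
  have hcont : ContinuousOn (fun x => -(ψ x * deriv (boundaryCutoff ε) (ρ x)) * g x)
      (tsupport ψ ∩ {x | ρ x ≤ -ε}) :=
    ((hψ.continuousOn.mul (hd.comp_continuousOn (h.contDiffOn.continuousOn.mono
      (hKV.trans inter_subset_right)))).neg).mul (hg.mono hKV)
  refine (hcont.integrableOn_compact hK).of_forall_sdiff_eq_zero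
    (hΩ.inter h.isOpen).measurableSet fun x hx => ?_
  by_cases hxs : x ∈ tsupport ψ
  · have : -ε < ρ x := by
      by_contra! hle
      exact hx.2 ⟨hxs, hle⟩
    rw [deriv_boundaryCutoff_eq_zero_of_gt hε this]
    simp
  · rw [image_eq_zero_of_notMem_tsupport hxs]
    simp

/-- The function `η_ε(ρ) ψ` has compact support inside `Ω ∩ B`, so the interior divergence theorem
applies to its product with `G`. The term where the derivative falls on `η_ε(ρ)` lives in the layer
`-2ε ≤ ρ ≤ -ε` and plays the part of the surface integral. -/
theorem integral_boundaryCutoff_eq (h : IsLocalDefiningFunction Ω x₀ B ρ) (hΩ : IsOpen Ω)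
    (hψ : ContDiff ℝ 1 ψ) (hψc : HasCompactSupport ψ) (hψB : tsupport ψ ⊆ B) (hε : 0 < ε)
    (hG : ContDiffOn ℝ 1 G (Ω ∩ B))
    (hint : IntegrableOn (fun x => ψ x * divergence G x + fderiv ℝ ψ x (G x)) (Ω ∩ B)) :
    ∫ x in Ω ∩ B, boundaryCutoff ε (ρ x) * (ψ x * divergence G x + fderiv ℝ ψ x (G x)) =
      ∫ x in Ω ∩ B, -(ψ x * deriv (boundaryCutoff ε) (ρ x)) * fderiv ℝ ρ x (G x) := by
  have hVo : IsOpen (Ω ∩ B) := hΩ.inter h.isOpen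
  have hη : ContDiff ℝ 1 (boundaryCutoff ε) := contDiff_boundaryCutoff (n := 1)
  have hρ1 : ContDiffOn ℝ 1 ρ B := h.contDiffOn.of_le (by simp)
  have hζ : ContDiff ℝ 1 fun y => boundaryCutoff ε (ρ y) * ψ y := by
    rw [contDiff_iff_contDiffAt]
    intro y
    by_cases hy : y ∈ B
    · exact (hη.contDiffAt.comp y (hρ1.contDiffAt (h.isOpen.mem_nhds hy))).mul hψ.contDiffAt
    · have hy' : y ∉ tsupport ψ := fun h' => hy (hψB h')
      refine (contDiffAt_const (c := (0 : ℝ))).congr_of_eventuallyEq ?_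
      filter_upwards [notMem_tsupport_iff_eventuallyEq.1 hy'] with z hz
      simp [hz]
  have hcut := setIntegral_cutoff_eq_zero (S := Ω ∩ B) hVo hG hζ
    (isCompact_inner_support (ε := ε) h hψc hψB) (inner_support_subset h hψB hε)
    (inner_support_subset h hψB hε) (fun y hy => by
      by_cases hys : y ∈ tsupport ψ
      · have : -ε < ρ y := by
          by_contra! hle
          exact hy ⟨hys, hle⟩
        rw [boundaryCutoff_eq_zero hε this.le, zero_mul]
      · rw [image_eq_zero_of_notMem_tsupport hys, mul_zero])
  have hρ' : ContinuousOn (fun x => fderiv ℝ ρ x (G x)) (Ω ∩ B) :=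
    ((hρ1.continuousOn_fderiv_of_isOpen h.isOpen le_rfl).mono inter_subset_right).clm_apply
      hG.continuousOn
  have hint1 : IntegrableOn (fun x => boundaryCutoff ε (ρ x) *
      (ψ x * divergence G x + fderiv ℝ ψ x (G x))) (Ω ∩ B) := by
    refine Integrable.bdd_mul (c := 1) hint ?_ (Eventually.of_forall fun x => ?_)
    · exact (hη.continuous.comp_continuousOn
        (hρ1.continuousOn.mono inter_subset_right)).aestronglyMeasurable hVo.measurableSet
    · rw [Real.norm_of_nonneg boundaryCutoff_nonneg]
      exact boundaryCutoff_le_one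
  have hint2 := integrableOn_boundaryLayer h hΩ hψ.continuous hψc hψB hε hρ'
  rw [← sub_eq_zero, ← integral_sub hint1 hint2, ← hcut]
  refine setIntegral_congr_fun hVo.measurableSet fun x hx => ?_
  have hρx : DifferentiableAt ℝ ρ x :=
    (hρ1.contDiffAt (h.isOpen.mem_nhds hx.2)).differentiableAt one_ne_zero
  have hηx : HasDerivAt (boundaryCutoff ε) (deriv (boundaryCutoff ε) (ρ x)) (ρ x) :=
    (hη.differentiable one_ne_zero _).hasDerivAt
  have hfd := ((hηx.comp_hasFDerivAt x hρx.hasFDerivAt).mul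
    (hψ.differentiable one_ne_zero x).hasFDerivAt).fderiv
  change _ = boundaryCutoff ε (ρ x) * ψ x * divergence G x +
    fderiv ℝ ((boundaryCutoff ε ∘ ρ) * ψ) x (G x)
  rw [hfd]
  simp
  ring

/-- The normal component of a field that is tangential on the boundary is small near it. -/
theorem exists_normal_component_lt (hΩ : IsOpen Ω)
    (h : ∀ y ∈ B, IsLocalDefiningFunction Ω y B ρ) (hψc : HasCompactSupport ψ)
    (hψB : tsupport ψ ⊆ B) (hG : ContinuousOn G (closure Ω))
    (hnormal : ∀ y ∈ frontier Ω, ∀ U ρ, IsLocalDefiningFunction Ω y U ρ → fderiv ℝ ρ y (G y) = 0)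
    {δ : ℝ} (hδ : 0 < δ) :
    ∃ m : ℝ, 0 < m ∧ ∀ y ∈ tsupport ψ, y ∈ Ω → -m < ρ y → |fderiv ℝ ρ y (G y)| ≤ δ := by
  rcases (tsupport ψ).eq_empty_or_nonempty with he | ⟨y₀, hy₀⟩
  · exact ⟨1, one_pos, fun y hy => by simp [he] at hy⟩
  have h0 := h y₀ (hψB hy₀)
  have hK : IsCompact (tsupport ψ ∩ closure Ω) := hψc.isCompact.inter_right isClosed_closure
  have hρ' : ContinuousOn (fun x => |fderiv ℝ ρ x (G x)|) (tsupport ψ ∩ closure Ω) :=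
    ((((h0.contDiffOn.continuousOn_fderiv_of_isOpen h0.isOpen (by simp)).mono hψB).mono
      inter_subset_left).clm_apply (hG.mono inter_subset_right)).abs
  have hK2 : IsCompact ((tsupport ψ ∩ closure Ω) ∩ {x | δ ≤ |fderiv ℝ ρ x (G x)|}) :=
    hK.of_isClosed_subset (hρ'.preimage_isClosed_of_isClosed hK.isClosed isClosed_Ici)
      inter_subset_left
  rcases ((tsupport ψ ∩ closure Ω) ∩ {x | δ ≤ |fderiv ℝ ρ x (G x)|}).eq_empty_or_nonempty
    with he | hne
  · refine ⟨1, one_pos, fun y hy hyΩ _ => ?_⟩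
    by_contra! hlt
    have : y ∈ (∅ : Set (EuclideanSpace ℝ (Fin N))) := he ▸ ⟨⟨hy, subset_closure hyΩ⟩, hlt.le⟩
    exact this
  -- Among the points of the support in `closure Ω` where the normal component is at least `δ`, `z`
  -- is the one closest to the boundary as measured by `ρ`. Tangency rules out `ρ z = 0`, so `m = -ρ
  -- z` is positive.
  · obtain ⟨z, hz, hmax⟩ := hK2.exists_isMaxOn hne
      (h0.contDiffOn.continuousOn.mono fun y hy => hψB hy.1.1)
    have hzB : z ∈ B := hψB hz.1.1
    have hneg : ρ z < 0 := by
      rw [← h0.mem_iff hzB]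
      by_contra hzΩ
      have := hnormal z ⟨hz.1.2, by rwa [hΩ.interior_eq]⟩ B ρ (h z hzB)
      have h2 : δ ≤ |fderiv ℝ ρ z (G z)| := hz.2
      rw [this, abs_zero] at h2
      linarith
    refine ⟨-ρ z, by linarith, fun y hy hyΩ hlt => ?_⟩
    by_contra! hgt
    have : ρ y ≤ ρ z := hmax ⟨⟨hy, subset_closure hyΩ⟩, hgt.le⟩
    linarith

/-- Let `ε → 0` in `integral_boundaryCutoff_eq`. The left side converges to the wanted integral by
dominated convergence. The right side tends to `0`: the layer weights `-ψ η_ε'(ρ)` are nonnegative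
with total mass bounded uniformly in `ε`, while the normal component of `G` is uniformly small on
the layer. -/
theorem integral_localized_divergence_eq_zero (hΩ : IsOpen Ω)
    (h : ∀ y ∈ B, IsLocalDefiningFunction Ω y B ρ)
    {n : EuclideanSpace ℝ (Fin N)} {c : ℝ} (hc : 0 < c) (hn : ∀ y ∈ B, c ≤ fderiv ℝ ρ y n)
    (hψ : ContDiff ℝ 1 ψ) (hψ0 : ∀ x, 0 ≤ ψ x) (hψc : HasCompactSupport ψ) (hψB : tsupport ψ ⊆ B)
    (hG : ContinuousOn G (closure Ω)) (hG1 : ContDiffOn ℝ 1 G Ω)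
    (hnormal : ∀ y ∈ frontier Ω, ∀ U ρ, IsLocalDefiningFunction Ω y U ρ → fderiv ℝ ρ y (G y) = 0)
    (hint : IntegrableOn (fun x => ψ x * divergence G x + fderiv ℝ ψ x (G x)) Ω) :
    ∫ x in Ω, (ψ x * divergence G x + fderiv ℝ ψ x (G x)) = 0 := by
  rcases (tsupport ψ).eq_empty_or_nonempty with he | ⟨y₀, hy₀⟩
  · have : ψ = fun _ => 0 := tsupport_eq_empty_iff.1 he
    simp [this]
  have h0 := h y₀ (hψB hy₀)
  have hVo : IsOpen (Ω ∩ B) := hΩ.inter h0.isOpen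
  have hintV := hint.mono_set (inter_subset_left (t := B))
  have hV : ∫ x in Ω ∩ B, (ψ x * divergence G x + fderiv ℝ ψ x (G x)) =
      ∫ x in Ω, (ψ x * divergence G x + fderiv ℝ ψ x (G x)) := by
    refine (setIntegral_eq_of_subset_of_forall_sdiff_eq_zero hΩ.measurableSet inter_subset_left
      fun x hx => ?_).symm
    have hxs : x ∉ tsupport ψ := fun hxs => hx.2 ⟨hx.1, hψB hxs⟩
    have hev := notMem_tsupport_iff_eventuallyEq.1 hxs
    rw [hev.fderiv_eq, hev.eq_of_nhds]
    simp
  rw [← hV]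
  have hlim : Tendsto (fun ε => ∫ x in Ω ∩ B,
      boundaryCutoff ε (ρ x) * (ψ x * divergence G x + fderiv ℝ ψ x (G x))) (𝓝[>] 0)
      (𝓝 (∫ x in Ω ∩ B, (ψ x * divergence G x + fderiv ℝ ψ x (G x)))) := by
    refine tendsto_integral_filter_of_dominated_convergence
      (fun x => ‖ψ x * divergence G x + fderiv ℝ ψ x (G x)‖) (Eventually.of_forall fun ε => ?_)
      (Eventually.of_forall fun ε => Eventually.of_forall fun x => ?_) hintV.norm ?_
    · exact (((contDiff_boundaryCutoff (n := 1)).continuous.comp_continuousOn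
        (h0.contDiffOn.continuousOn.mono inter_subset_right)).aestronglyMeasurable
        hVo.measurableSet).mul hintV.aestronglyMeasurable
    · rw [norm_mul, Real.norm_of_nonneg boundaryCutoff_nonneg]
      exact mul_le_of_le_one_left (norm_nonneg _) boundaryCutoff_le_one
    · filter_upwards [ae_restrict_mem hVo.measurableSet] with x hx
      have hneg : ρ x < 0 := (h0.mem_iff hx.2).1 hx.1
      refine tendsto_const_nhds.congr' ?_
      have hev : ∀ᶠ ε : ℝ in 𝓝[>] 0, ε < -ρ x / 2 :=
        nhdsWithin_le_nhds (gt_mem_nhds (by linarith))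
      filter_upwards [hev, self_mem_nhdsWithin] with ε hε hε0
      rw [boundaryCutoff_eq_one hε0 (by linarith), one_mul]
  have hψ'c : Continuous fun x => fderiv ℝ ψ x n :=
    (hψ.continuous_fderiv one_ne_zero).clm_apply continuous_const
  have hn_int : IntegrableOn (fun x => fderiv ℝ ψ x n) (Ω ∩ B) :=
    (hψ'c.integrable_of_hasCompactSupport (hψc.fderiv_apply ℝ _)).integrableOn
  have hdivn : ∀ x, divergence (fun _ => n) x = 0 := fun x => by simp [divergence]
  set M := ∫ x in Ω ∩ B, ‖fderiv ℝ ψ x n‖ with hM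
  have hw0 : ∀ {ε}, 0 < ε → ∀ x, 0 ≤ -(ψ x * deriv (boundaryCutoff ε) (ρ x)) := fun hε x => by
    have := mul_nonneg (hψ0 x) (neg_nonneg.2 (deriv_boundaryCutoff_nonpos (t := ρ x) hε))
    linarith
  have hw : ∀ {ε}, 0 < ε →
      IntegrableOn (fun x => -(ψ x * deriv (boundaryCutoff ε) (ρ x))) (Ω ∩ B) := fun hε => by
    simpa using integrableOn_boundaryLayer h0 hΩ hψ.continuous hψc hψB hε
      (g := fun _ => 1) continuousOn_const
  have hρ1 : ContDiffOn ℝ 1 ρ B := h0.contDiffOn.of_le (by simp)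
  have hρc : ContinuousOn (fderiv ℝ ρ) (Ω ∩ B) :=
    (hρ1.continuousOn_fderiv_of_isOpen h0.isOpen le_rfl).mono inter_subset_right
  -- The mass bound comes from the same identity for the constant field `n`, which has zero
  -- divergence and satisfies `∂ρ(n) ≥ c`.
  have hmass : ∀ {ε}, 0 < ε →
      c * ∫ x in Ω ∩ B, -(ψ x * deriv (boundaryCutoff ε) (ρ x)) ≤ M := fun {ε} hε => by
    have heq := integral_boundaryCutoff_eq h0 hΩ hψ hψc hψB hε (G := fun _ => n) contDiffOn_const
      (by simpa [hdivn] using hn_int)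
    simp only [hdivn, mul_zero, zero_add] at heq
    calc c * ∫ x in Ω ∩ B, -(ψ x * deriv (boundaryCutoff ε) (ρ x))
        = ∫ x in Ω ∩ B, -(ψ x * deriv (boundaryCutoff ε) (ρ x)) * c := by
          rw [integral_mul_const, mul_comm]
      _ ≤ ∫ x in Ω ∩ B, -(ψ x * deriv (boundaryCutoff ε) (ρ x)) * fderiv ℝ ρ x n := by
          refine setIntegral_mono_on ((hw hε).mul_const c)
            (integrableOn_boundaryLayer h0 hΩ hψ.continuous hψc hψB hε
              (hρc.clm_apply continuousOn_const)) hVo.measurableSet fun x hx => ?_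
          exact mul_le_mul_of_nonneg_left (hn x hx.2) (hw0 hε x)
      _ = ∫ x in Ω ∩ B, boundaryCutoff ε (ρ x) * fderiv ℝ ψ x n := heq.symm
      _ ≤ M := by
          refine (Real.le_norm_self _).trans (norm_integral_le_of_norm_le hn_int.norm
            (Eventually.of_forall fun x => ?_))
          rw [norm_mul, Real.norm_of_nonneg boundaryCutoff_nonneg]
          exact mul_le_of_le_one_left (norm_nonneg _) boundaryCutoff_le_one
  have hsmall : Tendsto (fun ε => ∫ x in Ω ∩ B,
      boundaryCutoff ε (ρ x) * (ψ x * divergence G x + fderiv ℝ ψ x (G x))) (𝓝[>] 0) (𝓝 0) := by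
    rw [Metric.tendsto_nhds]
    intro δ hδ
    have hM0 : 0 ≤ M := integral_nonneg fun x => norm_nonneg _
    -- The layer weights have mass at most `M / c`, so this tolerance makes the integral at most `δ
    -- M / (M + 1) < δ`. Taking `ε < m / 2` puts the whole layer in the region `-m < ρ`.
    obtain ⟨m, hm, hmδ⟩ := exists_normal_component_lt hΩ h hψc hψB hG hnormal
      (δ := δ * c / (M + 1)) (by positivity)
    have hev : ∀ᶠ ε : ℝ in 𝓝[>] 0, ε < m / 2 := nhdsWithin_le_nhds (gt_mem_nhds (by linarith))
    filter_upwards [hev, self_mem_nhdsWithin] with ε hε hε0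
    replace hε0 : 0 < ε := hε0
    rw [integral_boundaryCutoff_eq h0 hΩ hψ hψc hψB hε0 (hG1.mono inter_subset_left) hintV,
      dist_zero_right]
    have hle : ‖∫ x in Ω ∩ B, -(ψ x * deriv (boundaryCutoff ε) (ρ x)) * fderiv ℝ ρ x (G x)‖ ≤
        ∫ x in Ω ∩ B, -(ψ x * deriv (boundaryCutoff ε) (ρ x)) * (δ * c / (M + 1)) := by
      refine norm_integral_le_of_norm_le ((hw hε0).mul_const _) ?_
      filter_upwards [ae_restrict_mem hVo.measurableSet] with x hx
      rw [norm_mul, Real.norm_of_nonneg (hw0 hε0 x)]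
      by_cases hxs : x ∈ tsupport ψ
      · by_cases hxm : -m < ρ x
        · exact mul_le_mul_of_nonneg_left (hmδ x hxs hx.1 hxm) (hw0 hε0 x)
        · rw [deriv_boundaryCutoff_eq_zero_of_lt hε0 (by linarith)]
          simp
      · rw [image_eq_zero_of_notMem_tsupport hxs]
        simp
    refine hle.trans_lt ?_
    rw [integral_mul_const]
    have := hmass hε0
    have h3 : (∫ x in Ω ∩ B, -(ψ x * deriv (boundaryCutoff ε) (ρ x))) * (δ * c / (M + 1)) =
        (c * ∫ x in Ω ∩ B, -(ψ x * deriv (boundaryCutoff ε) (ρ x))) * (δ / (M + 1)) := by ring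
    rw [h3]
    calc _ ≤ M * (δ / (M + 1)) := by gcongr
      _ < δ := by
        rw [mul_div_assoc', div_lt_iff₀ (by linarith)]
        nlinarith
  exact tendsto_nhds_unique hlim hsmall

end LocalDivergence

/-! ### Globalization by a partition of unity. -/

section GlobalDivergence

variable {N : ℕ} {Ω : Set (EuclideanSpace ℝ (Fin N))}

/-- The predicate `p` lets interior sets and boundary charts enter one partition together. Passing
to a finite subcover first makes the sum finite. -/
theorem exists_finite_partition_of_unity {K : Set (EuclideanSpace ℝ (Fin N))} (hK : IsCompact K)
    {p : Set (EuclideanSpace ℝ (Fin N)) → Prop} (hp : ∀ x ∈ K, ∃ V, IsOpen V ∧ x ∈ V ∧ p V) :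
    ∃ (s : Finset (EuclideanSpace ℝ (Fin N)))
      (ψ : EuclideanSpace ℝ (Fin N) → EuclideanSpace ℝ (Fin N) → ℝ),
      (∀ i ∈ s, ContDiff ℝ 1 (ψ i) ∧ (∀ x, 0 ≤ ψ i x) ∧ ∃ V, p V ∧ tsupport (ψ i) ⊆ V) ∧
      ∀ x ∈ K, ∑ i ∈ s, ψ i x = 1 := by
  choose! V hVo hxV hpV using hp
  obtain ⟨s, hsK, hs⟩ := hK.elim_nhds_subcover V fun x hx => (hVo x hx).mem_nhds (hxV x hx)
  obtain ⟨f, hf⟩ := SmoothPartitionOfUnity.exists_isSubordinate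
    (modelWithCornersSelf ℝ (EuclideanSpace ℝ (Fin N))) hK.isClosed (fun i : s => V i)
    (fun i => hVo i (hsK i i.2)) (fun x hx => by simpa using hs hx)
  classical
  refine ⟨s, fun i => if h : i ∈ s then f ⟨i, h⟩ else 0, fun i hi => ?_, fun x hx => ?_⟩
  · simp only [hi, dif_pos]
    exact ⟨(f ⟨i, hi⟩).contMDiff.contDiff.of_le (by simp), fun x => f.nonneg _ x,
      V i, hpV i (hsK i hi), hf ⟨i, hi⟩⟩
  · rw [← f.sum_eq_one hx, finsum_eq_sum_of_fintype, ← Finset.sum_coe_sort s]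
    exact Finset.sum_congr rfl fun i _ => by simp

/-- The divergence theorem for a field with vanishing normal component on the boundary. -/
theorem IsSmoothBoundedDomain.integral_divergence_eq_zero (hΩ : IsSmoothBoundedDomain Ω)
    {G : EuclideanSpace ℝ (Fin N) → EuclideanSpace ℝ (Fin N)}
    (hG : ContinuousOn G (closure Ω)) (hG1 : ContDiffOn ℝ 1 G Ω)
    (hint : IntegrableOn (divergence G) Ω)
    (hnormal : ∀ y ∈ frontier Ω, ∀ U ρ, IsLocalDefiningFunction Ω y U ρ →
      fderiv ℝ ρ y (G y) = 0) :
    ∫ x in Ω, divergence G x = 0 := by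
  have hK : IsCompact (closure Ω) := hΩ.isBounded.isCompact_closure
  obtain ⟨s, ψ, hψ, hsum⟩ := exists_finite_partition_of_unity hK
    (p := fun V => Bornology.IsBounded V ∧ (V ⊆ Ω ∨ ∃ ρ n c, 0 < c ∧
      (∀ y ∈ V, IsLocalDefiningFunction Ω y V ρ) ∧ ∀ y ∈ V, c ≤ fderiv ℝ ρ y n))
    (fun x hx => by
      by_cases hxΩ : x ∈ Ω
      · exact ⟨Ω, hΩ.isOpen, hxΩ, hΩ.isBounded, Or.inl subset_rfl⟩
      · obtain ⟨R, ρ, n, c, hR, hc, h, hn⟩ :=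
          hΩ.exists_boundary_chart (x := x) ⟨hx, by rwa [hΩ.isOpen.interior_eq]⟩
        exact ⟨Metric.ball x R, Metric.isOpen_ball, Metric.mem_ball_self hR,
          Metric.isBounded_ball, Or.inr ⟨ρ, n, c, hc, h, hn⟩⟩)
  have hcs : ∀ i ∈ s, HasCompactSupport (ψ i) := fun i hi => by
    obtain ⟨_, _, V, ⟨hb, _⟩, hV⟩ := hψ i hi
    exact Metric.isCompact_of_isClosed_isBounded (isClosed_tsupport _) (hb.subset hV)
  have hGd : ∀ x ∈ Ω, DifferentiableAt ℝ G x := fun x hx =>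
    (hG1.contDiffAt (hΩ.isOpen.mem_nhds hx)).differentiableAt one_ne_zero
  have hinti : ∀ i ∈ s,
      IntegrableOn (fun x => ψ i x * divergence G x + fderiv ℝ (ψ i) x (G x)) Ω := fun i hi => by
    refine Integrable.add ?_ ?_
    · obtain ⟨C, hC⟩ := (hcs i hi).exists_bound_of_continuous (hψ i hi).1.continuous
      exact hint.bdd_mul (c := C) (hψ i hi).1.continuous.aestronglyMeasurable
        (Eventually.of_forall hC)
    · exact (((((hψ i hi).1.continuous_fderiv one_ne_zero).continuousOn).clm_apply
        hG).integrableOn_compact hK).mono_set subset_closure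
  -- The functions `ψ i` sum to `1` throughout the open set `Ω`, so `G` equals `∑ ψ i • G` near `x`
  -- and may be differentiated term by term.
  have hdiv : ∀ x ∈ Ω, divergence G x =
      ∑ i ∈ s, (ψ i x * divergence G x + fderiv ℝ (ψ i) x (G x)) := fun x hx => by
    have hev : G =ᶠ[𝓝 x] fun y => ∑ i ∈ s, ψ i y • G y := by
      filter_upwards [hΩ.isOpen.mem_nhds hx] with y hy
      rw [← Finset.sum_smul, hsum y (subset_closure hy), one_smul]
    have hd : ∀ i ∈ s, DifferentiableAt ℝ (ψ i) x := fun i hi =>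
      (hψ i hi).1.differentiable one_ne_zero x
    exact (divergence_congr hev).trans
      ((divergence_sum fun i hi => (hd i hi).fun_smul (hGd x hx)).trans
        (Finset.sum_congr rfl fun i hi => divergence_smul (hd i hi) (hGd x hx)))
  rw [setIntegral_congr_fun hΩ.isOpen.measurableSet hdiv, integral_finsetSum _ hinti]
  refine Finset.sum_eq_zero fun i hi => ?_
  obtain ⟨hψ1, hψ0, V, ⟨_, hVΩ | ⟨ρ, n, c, hc, h, hn⟩⟩, hV⟩ := hψ i hi
  · exact setIntegral_cutoff_eq_zero hΩ.isOpen hG1 hψ1 (hcs i hi) (hV.trans hVΩ) (hV.trans hVΩ)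
      fun x hx => image_eq_zero_of_notMem_tsupport hx
  · exact integral_localized_divergence_eq_zero hΩ.isOpen h hc hn hψ1 hψ0 (hcs i hi) hV hG hG1
      hnormal (hinti i hi)

end GlobalDivergence

/-! ### Green's identity for solutions. -/

section Energy

variable {N : ℕ} {Ω : Set (EuclideanSpace ℝ (Fin N))}

theorem contDiffOn_gradient (hΩ : IsOpen Ω) {u : EuclideanSpace ℝ (Fin N) → ℝ}
    (hu : ContDiffOn ℝ 2 u Ω) : ContDiffOn ℝ 1 (∇ u) Ω := by
  have h1 : ContDiffOn ℝ 1 (fderiv ℝ u) Ω := hu.fderiv_of_isOpen hΩ (by norm_num)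
  exact (InnerProductSpace.toDual ℝ (EuclideanSpace ℝ (Fin N))).symm.contDiff.comp_contDiffOn h1

theorem divergence_gradient (hΩ : IsOpen Ω) {u : EuclideanSpace ℝ (Fin N) → ℝ}
    (hu : ContDiffOn ℝ 2 u Ω) {x : EuclideanSpace ℝ (Fin N)} (hx : x ∈ Ω) :
    divergence (∇ u) x = Laplacian.laplacian u x := by
  have h1 : DifferentiableAt ℝ (fderiv ℝ u) x :=
    ((hu.fderiv_of_isOpen hΩ (m := 1) (by norm_num)).contDiffAt
      (hΩ.mem_nhds hx)).differentiableAt one_ne_zero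
  have h2 : DifferentiableAt ℝ (∇ u) x :=
    ((contDiffOn_gradient hΩ hu).contDiffAt (hΩ.mem_nhds hx)).differentiableAt one_ne_zero
  rw [InnerProductSpace.laplacian_eq_iteratedFDeriv_orthonormalBasis u
    (EuclideanSpace.basisFun (Fin N) ℝ)]
  refine Finset.sum_congr rfl fun i _ => ?_
  have h3 : HasFDerivAt (fun y => (∇ u y) i)
      ((EuclideanSpace.proj i : EuclideanSpace ℝ (Fin N) →L[ℝ] ℝ).comp (fderiv ℝ (∇ u) x)) x :=
    (EuclideanSpace.proj i : EuclideanSpace ℝ (Fin N) →L[ℝ] ℝ).hasFDerivAt.comp x h2.hasFDerivAt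
  have h4 : (fun y => (∇ u y) i) = fun y => fderiv ℝ u y (EuclideanSpace.single i 1) := by
    ext y
    rw [← inner_gradient_left (𝕜 := ℝ), EuclideanSpace.inner_single_right]
    simp
  have h5 := h1.hasFDerivAt.clm_apply
    (hasFDerivAt_const (EuclideanSpace.single i (1 : ℝ) : EuclideanSpace ℝ (Fin N)) x)
  rw [h4] at h3
  have h6 := congrArg (fun L => L (EuclideanSpace.single i (1 : ℝ))) (h3.unique h5)
  simp only [ContinuousLinearMap.comp_apply] at h6
  rw [iteratedFDeriv_two_apply]
  simpa using h6

/-- Green's identity for `φ(u) ∇u`, where `u` is a solution of the Neumann problem. -/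
theorem IsNonnegSolution.integral_energy_eq_zero (hΩ : IsSmoothBoundedDomain Ω)
    {a b u : EuclideanSpace ℝ (Fin N) → ℝ} {p q lam : ℝ} (hp : 2 < p) (hq : 1 < q)
    (ha : ContinuousOn a (closure Ω)) (hb : ContinuousOn b (closure Ω))
    (hu : IsNonnegSolution Ω a b p q lam u)
    {φ : ℝ → ℝ} {S : Set ℝ} (hS : IsOpen S) (hφ : ContDiffOn ℝ 1 φ S)
    (huS : ∀ x ∈ closure Ω, u x ∈ S) :
    ContinuousOn u (closure Ω) ∧ ∃ g : EuclideanSpace ℝ (Fin N) → EuclideanSpace ℝ (Fin N),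
      ContinuousOn g (closure Ω) ∧ EqOn g (∇ u) Ω ∧
      ∫ x in Ω, (deriv φ (u x) * ‖g x‖ ^ 2 -
        φ (u x) * (lam * b x * u x ^ (q - 1) + a x * u x ^ (p - 1))) = 0 := by
  obtain ⟨θ, -, -, hreg⟩ := hu.regular
  obtain ⟨g, hgc, hg⟩ := hreg.gradient_extends
  have huc := hreg.continuousOn
  refine ⟨huc, g, hgc, hg, ?_⟩
  have hK : IsCompact (closure Ω) := hΩ.isBounded.isCompact_closure
  have hφu : ContinuousOn (fun x => φ (u x)) (closure Ω) := hφ.continuousOn.comp huc huS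
  have hφ'u : ContinuousOn (fun x => deriv φ (u x)) (closure Ω) :=
    (hφ.continuousOn_deriv_of_isOpen hS le_rfl).comp huc huS
  have hcont : ContinuousOn (fun x => deriv φ (u x) * ‖g x‖ ^ 2 -
      φ (u x) * (lam * b x * u x ^ (q - 1) + a x * u x ^ (p - 1))) (closure Ω) := by
    have h1 : ContinuousOn (fun x => u x ^ (q - 1)) (closure Ω) :=
      huc.rpow_const fun x _ => Or.inr (by linarith)
    have h2 : ContinuousOn (fun x => u x ^ (p - 1)) (closure Ω) :=
      huc.rpow_const fun x _ => Or.inr (by linarith)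
    exact (hφ'u.mul (hgc.norm.pow 2)).sub
      (hφu.mul (((continuousOn_const.mul hb).mul h1).add (ha.mul h2)))
  have hgrad := contDiffOn_gradient hΩ.isOpen hreg.contDiffOn
  have hg1 : ContDiffOn ℝ 1 g Ω := hgrad.congr hg
  have hu1 : ContDiffOn ℝ 1 u Ω := hreg.contDiffOn.of_le (by norm_num)
  have hφu1 : ContDiffOn ℝ 1 (fun x => φ (u x)) Ω :=
    hφ.comp hu1 fun x hx => huS x (subset_closure hx)
  have hdiv : ∀ x ∈ Ω, divergence (fun y => φ (u y) • g y) x = deriv φ (u x) * ‖g x‖ ^ 2 -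
      φ (u x) * (lam * b x * u x ^ (q - 1) + a x * u x ^ (p - 1)) := fun x hx => by
    have hx' := hΩ.isOpen.mem_nhds hx
    have hux : DifferentiableAt ℝ u x := (hu1.contDiffAt hx').differentiableAt one_ne_zero
    have hφx : HasDerivAt φ (deriv φ (u x)) (u x) :=
      ((hφ.contDiffAt (hS.mem_nhds (huS x (subset_closure hx)))).differentiableAt
        one_ne_zero).hasDerivAt
    have hfd := (hφx.comp_hasFDerivAt x hux.hasFDerivAt).fderiv
    rw [divergence_smul ((hφu1.contDiffAt hx').differentiableAt one_ne_zero)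
      ((hg1.contDiffAt hx').differentiableAt one_ne_zero),
      divergence_congr (hg.eventuallyEq_of_mem hx'), divergence_gradient hΩ.isOpen
      hreg.contDiffOn hx, ← hu.equation x hx]
    change _ + fderiv ℝ (φ ∘ u) x (g x) = _
    rw [hfd]
    simp only [smul_apply, smul_eq_mul]
    rw [← inner_gradient_left (𝕜 := ℝ), ← hg hx, real_inner_self_eq_norm_sq]
    ring
  rw [← setIntegral_congr_fun hΩ.isOpen.measurableSet hdiv]
  refine hΩ.integral_divergence_eq_zero (hφu.smul hgc) (hφu1.smul hg1)
    (((hcont.integrableOn_compact hK).mono_set subset_closure).congr_fun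
      (fun x hx => (hdiv x hx).symm) hΩ.isOpen.measurableSet) fun y hy U ρ h => ?_
  have hext : extendFrom Ω (∇ u) y = g y := by
    refine extendFrom_eq hy.1 ?_
    exact ((hgc y hy.1).mono_left (nhdsWithin_mono y subset_closure)).congr'
      (eventually_nhdsWithin_of_forall hg)
  -- The Neumann condition for the normal built from this particular `ρ`; cancelling the factor
  -- `‖∇ρ‖⁻¹` gives `∂ρ(g) = 0`, the tangency required by the divergence theorem.
  have hN := hu.neumann y hy _ ⟨U, ρ, h, rfl⟩
  rw [boundaryDeriv, hext, inner_smul_right, mul_eq_zero, or_iff_right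
    (inv_ne_zero (norm_ne_zero_iff.2 h.gradient_ne_zero))] at hN
  rw [map_smul, ← inner_gradient_left (𝕜 := ℝ), real_inner_comm, hN, smul_zero]

end Energy

/-! ### A weighted Poincaré inequality by translations. -/

section Poincare

variable {N : ℕ} {Ω : Set (EuclideanSpace ℝ (Fin N))}

/-- Nonnegativity of the variance: integrate `(f - m)² ≥ 0`, with `m` the mean. -/
theorem sq_intervalIntegral_le {f : ℝ → ℝ} (hf : ContinuousOn f (Icc 0 1)) :
    (∫ t in (0 : ℝ)..1, f t) ^ 2 ≤ ∫ t in (0 : ℝ)..1, f t ^ 2 := by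
  have hf' : ContinuousOn f (uIcc 0 1) := by rwa [uIcc_of_le zero_le_one]
  have h1 : IntervalIntegrable f volume 0 1 := hf'.intervalIntegrable
  have h2 : IntervalIntegrable (fun t => f t ^ 2) volume 0 1 := (hf'.pow 2).intervalIntegrable
  set m := ∫ t in (0 : ℝ)..1, f t with hm
  have h3 : 0 ≤ ∫ t in (0 : ℝ)..1, (f t ^ 2 - 2 * m * f t + m ^ 2) := by
    refine intervalIntegral.integral_nonneg zero_le_one fun t _ => ?_
    nlinarith [sq_nonneg (f t - m)]
  rw [intervalIntegral.integral_add (h2.sub (h1.const_mul _)) intervalIntegrable_const,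
    intervalIntegral.integral_sub h2 (h1.const_mul _), intervalIntegral.integral_const_mul,
    intervalIntegral.integral_const, ← hm] at h3
  simp only [sub_zero, one_smul] at h3
  nlinarith

/-- The fundamental theorem of calculus along the segment, followed by Cauchy–Schwarz. Extended
nonnegative integrals are used because the next integration is over `z`, where `∇u` need not be
square integrable. -/
theorem sq_le_of_segment_subset (hΩ : IsOpen Ω) {u : EuclideanSpace ℝ (Fin N) → ℝ}
    (hu : ContDiffOn ℝ 1 u Ω) {z h : EuclideanSpace ℝ (Fin N)}
    (hseg : ∀ t ∈ Icc (0 : ℝ) 1, z + t • h ∈ Ω) :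
    ENNReal.ofReal (u (z + h) ^ 2) ≤ 2 * ENNReal.ofReal (u z ^ 2) +
      2 * ENNReal.ofReal (‖h‖ ^ 2) *
        ∫⁻ t in Icc (0 : ℝ) 1, ENNReal.ofReal (‖fderiv ℝ u (z + t • h)‖ ^ 2) := by
  have hline : Continuous fun t : ℝ => z + t • h := by fun_prop
  have hDc : ContinuousOn (fun t : ℝ => fderiv ℝ u (z + t • h)) (Icc 0 1) :=
    (hu.continuousOn_fderiv_of_isOpen hΩ le_rfl).comp hline.continuousOn hseg
  have hfc : ContinuousOn (fun t : ℝ => fderiv ℝ u (z + t • h) h) (Icc 0 1) :=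
    hDc.clm_apply continuousOn_const
  have hderiv : ∀ t ∈ uIcc (0 : ℝ) 1, HasDerivAt (fun t : ℝ => u (z + t • h))
      (fderiv ℝ u (z + t • h) h) t := fun t ht => by
    rw [uIcc_of_le zero_le_one] at ht
    have h1 : HasDerivAt (fun t : ℝ => z + t • h) h t := by
      simpa using ((hasDerivAt_id t).smul_const h).const_add z
    exact ((hu.contDiffAt (hΩ.mem_nhds (hseg t ht))).differentiableAt
      one_ne_zero).hasFDerivAt.comp_hasDerivAt t h1
  have hint := intervalIntegral.integral_eq_sub_of_hasDerivAt hderiv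
    (by rw [← uIcc_of_le (zero_le_one' ℝ)] at hfc; exact hfc.intervalIntegrable)
  simp only [one_smul, zero_smul, add_zero] at hint
  have hDi : ContinuousOn (fun t : ℝ => ‖fderiv ℝ u (z + t • h)‖ ^ 2) (Icc 0 1) := hDc.norm.pow 2
  have hle : (u (z + h) - u z) ^ 2 ≤
      ‖h‖ ^ 2 * ∫ t in Icc (0 : ℝ) 1, ‖fderiv ℝ u (z + t • h)‖ ^ 2 := by
    rw [← hint, integral_Icc_eq_integral_Ioc, ← intervalIntegral.integral_of_le zero_le_one,
      ← intervalIntegral.integral_const_mul]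
    refine (sq_intervalIntegral_le hfc).trans ?_
    refine intervalIntegral.integral_mono_on zero_le_one ?_ ?_ fun t _ => ?_
    · exact ContinuousOn.intervalIntegrable (by rw [uIcc_of_le zero_le_one]; exact hfc.pow 2)
    · exact ContinuousOn.intervalIntegrable
        (by rw [uIcc_of_le zero_le_one]; exact continuousOn_const.mul hDi)
    · rw [← mul_pow, ← sq_abs, ← Real.norm_eq_abs, mul_comm]
      gcongr
      exact (fderiv ℝ u (z + t • h)).le_opNorm h
  have hI0 : 0 ≤ ∫ t in Icc (0 : ℝ) 1, ‖fderiv ℝ u (z + t • h)‖ ^ 2 :=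
    integral_nonneg fun t => by positivity
  rw [← ofReal_integral_eq_lintegral_ofReal (hDi.integrableOn_compact isCompact_Icc)
    (Eventually.of_forall fun t => by positivity)]
  have h3 : ∀ c : ℝ, 0 ≤ c → 2 * ENNReal.ofReal c = ENNReal.ofReal (2 * c) := fun c _ => by
    rw [ENNReal.ofReal_mul zero_le_two, ENNReal.ofReal_ofNat]
  rw [h3 _ (by positivity), h3 _ (by positivity),
    ← ENNReal.ofReal_mul (by positivity), ← ENNReal.ofReal_add (by positivity) (by positivity)]
  refine ENNReal.ofReal_le_ofReal ?_
  -- With `v = u (z + h)` and `w = u z`, this is `v² ≤ 2 w² + 2 (v - w)²`, whose defect is exactly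
  -- `(v - 2 w)²`.
  nlinarith [sq_nonneg (u (z + h) - 2 * u z)]

/-- The mass of `u ^ 2` on a translate of `W` is controlled by its mass on `W` and the Dirichlet
energy, if the translation stays in `Ω`. -/
theorem lintegral_sq_translate_le (hΩ : IsOpen Ω) {u : EuclideanSpace ℝ (Fin N) → ℝ}
    (hu : ContDiffOn ℝ 1 u Ω) {W W' : Set (EuclideanSpace ℝ (Fin N))} (hW' : MeasurableSet W')
    {h : EuclideanSpace ℝ (Fin N)} (hWW : ∀ z, z + h ∈ W' → z ∈ W)
    (hseg : ∀ z, z + h ∈ W' → ∀ t ∈ Icc (0 : ℝ) 1, z + t • h ∈ Ω) :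
    ∫⁻ z in W', ENNReal.ofReal (u z ^ 2) ≤ 2 * (∫⁻ z in W, ENNReal.ofReal (u z ^ 2)) +
      2 * ENNReal.ofReal (‖h‖ ^ 2) * ∫⁻ z in Ω, ENNReal.ofReal (‖fderiv ℝ u z‖ ^ 2) := by
  have hmeas : Measurable fun z => ENNReal.ofReal (‖fderiv ℝ u z‖ ^ 2) :=
    ((measurable_fderiv ℝ u).norm.pow_const 2).ennreal_ofReal
  have hmeas2 : Measurable fun y : EuclideanSpace ℝ (Fin N) × ℝ =>
      ENNReal.ofReal (‖fderiv ℝ u (y.1 + y.2 • h)‖ ^ 2) :=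
    hmeas.comp (f := fun y : EuclideanSpace ℝ (Fin N) × ℝ => y.1 + y.2 • h) (by fun_prop)
  set P : Set (EuclideanSpace ℝ (Fin N)) := {z | z + h ∈ W'} with hP
  have hPm : MeasurableSet P := hW'.preimage (measurable_add_const h)
  have hshift : ∀ (t : ℝ) (f : EuclideanSpace ℝ (Fin N) → ENNReal)
      (A A' : Set (EuclideanSpace ℝ (Fin N))), MeasurableSet A → MeasurableSet A' →
      (∀ z ∈ A, z + t • h ∈ A') → ∫⁻ z in A, f (z + t • h) ≤ ∫⁻ z in A', f z := by
    intro t f A A' hA hA' hAA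
    rw [← lintegral_indicator hA, ← lintegral_indicator hA',
      ← lintegral_add_right_eq_self (A'.indicator f) (t • h)]
    refine lintegral_mono fun z => ?_
    by_cases hz : z ∈ A
    · simp [hz, hAA z hz]
    · simp [hz]
  calc ∫⁻ z in W', ENNReal.ofReal (u z ^ 2)
      = ∫⁻ z in P, ENNReal.ofReal (u (z + h) ^ 2) := by
        rw [← lintegral_indicator hW', ← lintegral_indicator hPm,
          ← lintegral_add_right_eq_self (W'.indicator _) h]
        rfl
    _ ≤ ∫⁻ z in P, (2 * ENNReal.ofReal (u z ^ 2) + 2 * ENNReal.ofReal (‖h‖ ^ 2) *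
        ∫⁻ t in Icc (0 : ℝ) 1, ENNReal.ofReal (‖fderiv ℝ u (z + t • h)‖ ^ 2)) :=
        setLIntegral_mono' hPm fun z hz => sq_le_of_segment_subset hΩ hu (hseg z hz)
    _ = 2 * (∫⁻ z in P, ENNReal.ofReal (u z ^ 2)) + 2 * ENNReal.ofReal (‖h‖ ^ 2) *
        ∫⁻ z in P, ∫⁻ t in Icc (0 : ℝ) 1, ENNReal.ofReal (‖fderiv ℝ u (z + t • h)‖ ^ 2) := by
        rw [lintegral_add_right _ (hmeas2.lintegral_prod_right'.const_mul _),
          lintegral_const_mul' _ _ (by simp),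
          lintegral_const_mul' _ _ (ENNReal.mul_ne_top (by simp) (by simp))]
    _ ≤ _ := by
        refine add_le_add (by gcongr; exact hWW) (mul_le_mul_right ?_ _)
        -- After Tonelli, each fixed `t` gives the integral over a translate of `P` contained in
        -- `Ω`, hence at most the full Dirichlet energy.
        rw [lintegral_lintegral_swap (f := fun z t => ENNReal.ofReal (‖fderiv ℝ u (z + t • h)‖ ^ 2))
          hmeas2.aemeasurable]
        calc _ ≤ ∫⁻ t in Icc (0 : ℝ) 1, ∫⁻ z in Ω, ENNReal.ofReal (‖fderiv ℝ u z‖ ^ 2) :=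
                setLIntegral_mono' measurableSet_Icc fun t ht =>
                  hshift t (fun z => ENNReal.ofReal (‖fderiv ℝ u z‖ ^ 2)) P Ω hPm
                    hΩ.measurableSet fun z hz => hseg z hz t ht
            _ = _ := by simp

/-- The mass of `u ^ 2` on `V` is bounded by the Dirichlet energy of `u` on `Ω` and the weighted
mass of `u ^ 2`, uniformly in `u`. -/
def MassControlled (Ω : Set (EuclideanSpace ℝ (Fin N))) (b : EuclideanSpace ℝ (Fin N) → ℝ)
    (V : Set (EuclideanSpace ℝ (Fin N))) : Prop :=
  ∃ C : ℝ≥0, ∀ u : EuclideanSpace ℝ (Fin N) → ℝ, ContDiffOn ℝ 1 u Ω →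
    ∫⁻ z in V, ENNReal.ofReal (u z ^ 2) ≤ C * ((∫⁻ z in Ω, ENNReal.ofReal (‖fderiv ℝ u z‖ ^ 2)) +
      ∫⁻ z in Ω, ENNReal.ofReal (b z * u z ^ 2))

namespace MassControlled

variable {b : EuclideanSpace ℝ (Fin N) → ℝ} {V W : Set (EuclideanSpace ℝ (Fin N))}

theorem mono (hV : MassControlled Ω b V) (h : W ⊆ V) : MassControlled Ω b W := by
  obtain ⟨C, hC⟩ := hV
  exact ⟨C, fun u hu => (lintegral_mono_set h).trans (hC u hu)⟩

theorem union (hV : MassControlled Ω b V) (hW : MassControlled Ω b W) :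
    MassControlled Ω b (V ∪ W) := by
  obtain ⟨C, hC⟩ := hV
  obtain ⟨C', hC'⟩ := hW
  refine ⟨C + C', fun u hu => (lintegral_union_le _ _ _).trans ?_⟩
  rw [ENNReal.coe_add, add_mul]
  exact add_le_add (hC u hu) (hC' u hu)

theorem translate (hΩ : IsOpen Ω) (hW : MassControlled Ω b W) (hVm : MeasurableSet V)
    {h : EuclideanSpace ℝ (Fin N)} (hVW : ∀ z, z + h ∈ V → z ∈ W)
    (hseg : ∀ z, z + h ∈ V → ∀ t ∈ Icc (0 : ℝ) 1, z + t • h ∈ Ω) : MassControlled Ω b V := by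
  obtain ⟨C, hC⟩ := hW
  refine ⟨2 * C + 2 * (‖h‖ ^ 2).toNNReal, fun u hu => ?_⟩
  refine (lintegral_sq_translate_le hΩ hu hVm hVW hseg).trans ?_
  rw [ENNReal.coe_add, add_mul, ENNReal.coe_mul, ENNReal.coe_mul, mul_assoc (_ : ENNReal) (C : ENNReal)]
  gcongr
  · simp
  · exact hC u hu
  · simp
  · exact le_rfl
  · exact le_self_add

/-- The starting point of the propagation: here the weighted mass alone suffices. -/
theorem of_lt {β : ℝ} (hβ : 0 < β) (hVΩ : V ⊆ Ω) (hVm : MeasurableSet V)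
    (hb : ∀ z ∈ V, β ≤ b z) : MassControlled Ω b V := by
  refine ⟨(β⁻¹).toNNReal, fun u _ => ?_⟩
  calc ∫⁻ z in V, ENNReal.ofReal (u z ^ 2)
      ≤ ∫⁻ z in V, ENNReal.ofReal β⁻¹ * ENNReal.ofReal (b z * u z ^ 2) := by
        refine setLIntegral_mono' hVm fun z hz => ?_
        rw [← ENNReal.ofReal_mul (by positivity)]
        refine ENNReal.ofReal_le_ofReal ?_
        rw [inv_mul_eq_div, le_div_iff₀ hβ, mul_comm]
        exact mul_le_mul_of_nonneg_right (hb z hz) (sq_nonneg _)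
    _ = ENNReal.ofReal β⁻¹ * ∫⁻ z in V, ENNReal.ofReal (b z * u z ^ 2) :=
        lintegral_const_mul' _ _ (by simp)
    _ ≤ _ := by
        change _ ≤ ENNReal.ofReal β⁻¹ * _
        gcongr
        exact (lintegral_mono_set hVΩ).trans le_add_self

end MassControlled

theorem exists_mem_ne_zero_of_closure {b : EuclideanSpace ℝ (Fin N) → ℝ}
    (hb : ContinuousOn b (closure Ω)) (hb0 : ∃ x ∈ closure Ω, b x ≠ 0) : ∃ x ∈ Ω, b x ≠ 0 := by
  by_contra! h
  obtain ⟨x, hx, hne⟩ := hb0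
  have hsub : closure Ω ⊆ closure Ω ∩ b ⁻¹' {0} :=
    closure_minimal (fun y hy => ⟨subset_closure hy, h y hy⟩)
      (hb.preimage_isClosed_of_isClosed isClosed_closure isClosed_singleton)
  exact hne (hsub hx).2

/-- A connectedness argument. The set of centres of controlled balls is open, contains a point where
`b > 0`, and is relatively closed in `Ω`, since control moves from a nearby centre to a limit point
by translation. -/
theorem massControlled_ball_of_mem (hΩ : IsSmoothBoundedDomain Ω)
    {b : EuclideanSpace ℝ (Fin N) → ℝ} (hb : ContinuousOn b (closure Ω))
    (hb0 : ∃ x ∈ closure Ω, b x ≠ 0) (hbnn : ∀ x ∈ closure Ω, 0 ≤ b x)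
    {x : EuclideanSpace ℝ (Fin N)} (hx : x ∈ Ω) :
    ∃ r : ℝ, 0 < r ∧ MassControlled Ω b (Metric.ball x r) := by
  set S : Set (EuclideanSpace ℝ (Fin N)) := {x | ∃ r : ℝ, 0 < r ∧
    MassControlled Ω b (Metric.ball x r)} with hS
  have hSo : IsOpen S := by
    refine Metric.isOpen_iff.2 fun y hy => ?_
    obtain ⟨r, hr, h⟩ := hy
    refine ⟨r / 2, by linarith, fun z hz => ?_⟩
    refine ⟨r / 2, by linarith, h.mono (Metric.ball_subset_ball' ?_)⟩
    have := Metric.mem_ball.1 hz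
    linarith
  refine hΩ.isConnected.isPreconnected.subset_of_closure_inter_subset hSo ?_ ?_ hx
  · obtain ⟨y, hy, hne⟩ := exists_mem_ne_zero_of_closure hb hb0
    have hpos : 0 < b y := lt_of_le_of_ne (hbnn y (subset_closure hy)) hne.symm
    have hcont : ContinuousAt b y :=
      (hb.mono subset_closure).continuousAt (hΩ.isOpen.mem_nhds hy)
    obtain ⟨r, hr, hball⟩ := Metric.mem_nhds_iff.1
      (inter_mem (hcont.eventually (lt_mem_nhds (half_lt_self hpos))) (hΩ.isOpen.mem_nhds hy))
    exact ⟨y, hy, r, hr, MassControlled.of_lt (half_pos hpos) (fun z hz => (hball hz).2)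
      measurableSet_ball fun z hz => le_of_lt (hball hz).1⟩
  · rintro y ⟨hyc, hyΩ⟩
    obtain ⟨R, hR, hball⟩ := Metric.isOpen_iff.1 hΩ.isOpen y hyΩ
    obtain ⟨z, ⟨r, hr, hzr⟩, hyz⟩ := Metric.mem_closure_iff.1 hyc (R / 2) (by linarith)
    have hs : 0 < min r (R / 2) := lt_min hr (by linarith)
    -- The ball radius and the translation `y - z` are each at most `R / 2`, so every segment stays
    -- in the ball of radius `R` about `y`.
    refine ⟨min r (R / 2), hs, hzr.translate hΩ.isOpen measurableSet_ball
      (h := y - z) (fun w hw => ?_) fun w hw t ht => hball ?_⟩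
    · rw [Metric.mem_ball, dist_eq_norm] at hw ⊢
      have : w + (y - z) - y = w - z := by abel
      rw [this] at hw
      exact hw.trans_le (min_le_left _ _)
    · rw [Metric.mem_ball, dist_eq_norm] at hw ⊢
      have h1 : w + t • (y - z) - y = (w + (y - z) - y) - (1 - t) • (y - z) := by
        rw [sub_smul, one_smul]
        abel
      have h2 : ‖(1 - t) • (y - z)‖ ≤ ‖y - z‖ := by
        rw [norm_smul, Real.norm_of_nonneg (by linarith [ht.2])]
        exact mul_le_of_le_one_left (norm_nonneg _) (by linarith [ht.1])
      rw [dist_eq_norm] at hyz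
      rw [h1]
      have := norm_sub_le (w + (y - z) - y) ((1 - t) • (y - z))
      have := min_le_right r (R / 2)
      linarith

/-- Push the boundary patch inward along `-n`. There `ρ` decreases, so segments starting in `Ω` stay
in `Ω`, and the patch lands in a controlled interior ball about `x - τ • n`. -/
theorem massControlled_ball_of_mem_frontier (hΩ : IsSmoothBoundedDomain Ω)
    {b : EuclideanSpace ℝ (Fin N) → ℝ} (hb : ContinuousOn b (closure Ω))
    (hb0 : ∃ x ∈ closure Ω, b x ≠ 0) (hbnn : ∀ x ∈ closure Ω, 0 ≤ b x)
    {x : EuclideanSpace ℝ (Fin N)} (hx : x ∈ frontier Ω) :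
    ∃ r : ℝ, 0 < r ∧ MassControlled Ω b (Metric.ball x r ∩ Ω) := by
  obtain ⟨R, ρ, n, c, hR, hc, h, hn⟩ := hΩ.exists_boundary_chart hx
  have hx0 := h x (Metric.mem_ball_self hR)
  -- Chosen so that `τ ‖n‖ ≤ R / 2`: the half-radius ball remains in the chart while it is moved.
  -- The `+ 1` keeps the denominator positive without an appeal to `n ≠ 0`.
  set τ := R / (2 * (‖n‖ + 1)) with hτ
  have hn1 : 0 < ‖n‖ + 1 := by positivity
  have hτ0 : 0 < τ := by positivity
  have hτn : τ * ‖n‖ ≤ R / 2 := by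
    rw [hτ, div_mul_eq_mul_div, div_le_div_iff₀ (by positivity) (by norm_num)]
    nlinarith [norm_nonneg n]
  have hin : ∀ z ∈ Metric.ball x (R / 2), ∀ s ∈ Icc (0 : ℝ) τ, z - s • n ∈ Metric.ball x R := by
    intro z hz s hs
    rw [Metric.mem_ball, dist_eq_norm] at hz ⊢
    have h1 : z - s • n - x = (z - x) - s • n := by abel
    have h2 : ‖s • n‖ ≤ R / 2 := by
      rw [norm_smul, Real.norm_of_nonneg hs.1]
      exact (mul_le_mul_of_nonneg_right hs.2 (norm_nonneg _)).trans hτn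
    rw [h1]
    have := norm_sub_le (z - x) (s • n)
    linarith
  have hdec : ∀ z ∈ Metric.ball x (R / 2), StrictAntiOn (fun s : ℝ => ρ (z - s • n))
      (Icc 0 τ) := by
    intro z hz
    have hd : ∀ s ∈ Icc (0 : ℝ) τ, HasDerivAt (fun s : ℝ => ρ (z - s • n))
        (fderiv ℝ ρ (z - s • n) (-n)) s := fun s hs => by
      have h1 : HasDerivAt (fun s : ℝ => z - s • n) (-n) s := by
        simpa using ((hasDerivAt_id s).smul_const n).const_sub z
      exact ((hx0.contDiffOn.contDiffAt (hx0.isOpen.mem_nhds (hin z hz s hs))).differentiableAt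
        (by simp)).hasFDerivAt.comp_hasDerivAt s h1
    refine strictAntiOn_of_deriv_neg (convex_Icc 0 τ)
      (fun s hs => (hd s hs).continuousAt.continuousWithinAt) fun s hs => ?_
    have hs' := interior_subset hs
    rw [(hd s hs').deriv, map_neg, neg_lt_zero]
    exact hc.trans_le (hn _ (hin z hz s hs'))
  have hτmem : τ ∈ Icc 0 τ := ⟨hτ0.le, le_rfl⟩
  have h0mem : (0 : ℝ) ∈ Icc 0 τ := ⟨le_rfl, hτ0.le⟩
  have hxball : x ∈ Metric.ball x (R / 2) := Metric.mem_ball_self (by linarith)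
  have hxτ : x - τ • n ∈ Ω := by
    rw [hx0.mem_iff (hin x hxball τ hτmem)]
    have h1 := hdec x hxball h0mem hτmem hτ0
    have h2 := hx0.nonpos_of_mem_closure (Metric.mem_ball_self hR) hx.1
    simp only [zero_smul, sub_zero] at h1
    linarith
  obtain ⟨r, hr, hctrl⟩ := massControlled_ball_of_mem hΩ hb hb0 hbnn hxτ
  have hs : 0 < min r (R / 2) := lt_min hr (by linarith)
  refine ⟨min r (R / 2), hs, hctrl.translate hΩ.isOpen
    (measurableSet_ball.inter hΩ.isOpen.measurableSet) (h := τ • n) (fun z hz => ?_)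
    fun z hz t ht => ?_⟩
  · have hz1 := hz.1
    rw [Metric.mem_ball, dist_eq_norm] at hz1 ⊢
    have : z - (x - τ • n) = z + τ • n - x := by abel
    rw [this]
    exact hz1.trans_le (min_le_left _ _)
  · have hzb : z + τ • n ∈ Metric.ball x (R / 2) :=
      Metric.ball_subset_ball (min_le_right _ _) hz.1
    have hst : (1 - t) * τ ∈ Icc 0 τ :=
      ⟨mul_nonneg (by linarith [ht.2]) hτ0.le, mul_le_of_le_one_left hτ0.le (by linarith [ht.1])⟩
    have heq : z + t • τ • n = z + τ • n - ((1 - t) * τ) • n := by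
      rw [smul_smul, sub_mul, one_mul, sub_smul]
      abel
    have h1 := (hdec _ hzb).antitoneOn h0mem hst hst.1
    simp only [zero_smul, sub_zero] at h1
    rw [heq, hx0.mem_iff (hin _ hzb _ hst)]
    refine lt_of_le_of_lt h1 ?_
    exact (hx0.mem_iff (Metric.ball_subset_ball (by linarith) hzb)).1 hz.2

/-- A Poincaré inequality with a nonnegative weight that does not vanish identically. -/
theorem IsSmoothBoundedDomain.massControlled (hΩ : IsSmoothBoundedDomain Ω)
    {b : EuclideanSpace ℝ (Fin N) → ℝ} (hb : ContinuousOn b (closure Ω))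
    (hb0 : ∃ x ∈ closure Ω, b x ≠ 0) (hbnn : ∀ x ∈ closure Ω, 0 ≤ b x) :
    MassControlled Ω b Ω := by
  have hK : IsCompact (closure Ω) := hΩ.isBounded.isCompact_closure
  refine MassControlled.mono (V := closure Ω ∩ Ω) ?_ fun x hx => ⟨subset_closure hx, hx⟩
  -- Control is stable under subsets and finite unions, so local control near each point of the
  -- compact closure is enough.
  refine hK.induction_on (p := fun s => MassControlled Ω b (s ∩ Ω)) ?_ ?_ ?_ fun x hx => ?_
  · exact ⟨0, fun u _ => by simp⟩
  · exact fun s t hst ht => ht.mono (inter_subset_inter_left _ hst)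
  · intro s t hs ht
    rw [union_inter_distrib_right]
    exact hs.union ht
  · by_cases hxΩ : x ∈ Ω
    · obtain ⟨r, hr, h⟩ := massControlled_ball_of_mem hΩ hb hb0 hbnn hxΩ
      exact ⟨_, mem_nhdsWithin_of_mem_nhds (Metric.ball_mem_nhds x hr), h.mono inter_subset_left⟩
    · obtain ⟨r, hr, h⟩ := massControlled_ball_of_mem_frontier hΩ hb hb0 hbnn (x := x)
        ⟨hx, by rwa [hΩ.isOpen.interior_eq]⟩
      exact ⟨_, mem_nhdsWithin_of_mem_nhds (Metric.ball_mem_nhds x hr), h⟩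

end Poincare

theorem MemHolderClosure.continuousOn {N : ℕ} {Ω : Set (EuclideanSpace ℝ (Fin N))} {α : ℝ≥0}
    {f : EuclideanSpace ℝ (Fin N) → ℝ} (hα : 0 < α) (hf : MemHolderClosure Ω α f) :
    ContinuousOn f (closure Ω) := by
  obtain ⟨C, hC⟩ := hf
  exact hC.continuousOn hα

theorem eqOn_zero_of_setIntegral_eq_zero {N : ℕ} {Ω : Set (EuclideanSpace ℝ (Fin N))}
    (hΩ : IsOpen Ω) {f : EuclideanSpace ℝ (Fin N) → ℝ} (hf : ContinuousOn f Ω)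
    (hf0 : ∀ x ∈ Ω, 0 ≤ f x) (hfi : IntegrableOn f Ω) (h : ∫ x in Ω, f x = 0) :
    ∀ x ∈ Ω, f x = 0 := by
  have hae : f =ᵐ[volume.restrict Ω] 0 :=
    (setIntegral_eq_zero_iff_of_nonneg_ae
      ((ae_restrict_mem hΩ.measurableSet).mono fun x hx => hf0 x hx) hfi).1 h
  exact fun x hx => Measure.eqOn_open_of_ae_eq hae hΩ hf continuousOn_const hx

/-! ### Nonexistence and the lower bound. -/

section Solutions

variable {N : ℕ} {Ω : Set (EuclideanSpace ℝ (Fin N))} {a b u : EuclideanSpace ℝ (Fin N) → ℝ}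
  {p q lam : ℝ}

/-- The exponent `1 - p` in the test function turns the `a`-term into `∫ a`, so all terms have a
sign and `∇u` must vanish. For `lam = 0` the equation then reads `a u^(p-1) = 0`; for `lam > 0` the
identity leaves `∫ b u^(q-p) = 0`. Each contradicts nontriviality of a coefficient. -/
theorem not_isPositiveSolution (hΩ : IsSmoothBoundedDomain Ω) (hq1 : 1 < q) (hp : 2 < p)
    (ha : ContinuousOn a (closure Ω)) (hb : ContinuousOn b (closure Ω))
    (ha_ne : ∃ x ∈ closure Ω, a x ≠ 0) (hb_ne : ∃ x ∈ closure Ω, b x ≠ 0)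
    (hb_nonneg : ∀ x ∈ closure Ω, 0 ≤ b x) (ha_int : 0 ≤ ∫ x in Ω, a x) (hlam : 0 ≤ lam) :
    ¬ IsPositiveSolution Ω a b p q lam u := by
  rintro ⟨hu, hpos⟩
  have hφ : ContDiffOn ℝ 1 (fun s : ℝ => s ^ (1 - p)) (Ioi 0) :=
    contDiffOn_id.rpow_const_of_ne fun s hs => ne_of_gt hs
  obtain ⟨huc, g, hgc, hg, hint⟩ :=
    hu.integral_energy_eq_zero hΩ hp hq1 ha hb isOpen_Ioi hφ hpos
  have hK : IsCompact (closure Ω) := hΩ.isBounded.isCompact_closure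
  have hm := hΩ.isOpen.measurableSet
  have hpow : ∀ s : ℝ, ContinuousOn (fun x => u x ^ s) (closure Ω) := fun s =>
    huc.rpow_const fun x hx => Or.inl (hpos x hx).ne'
  have hDc : ContinuousOn (fun x => u x ^ (-p) * ‖g x‖ ^ 2) (closure Ω) :=
    (hpow _).mul (hgc.norm.pow 2)
  have hBc : ContinuousOn (fun x => b x * u x ^ (q - p)) (closure Ω) := hb.mul (hpow _)
  have hi : ∀ {f : EuclideanSpace ℝ (Fin N) → ℝ}, ContinuousOn f (closure Ω) →
      IntegrableOn f Ω := fun hf => (hf.integrableOn_compact hK).mono_set subset_closure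
  have hD0 : ∀ x ∈ Ω, 0 ≤ u x ^ (-p) * ‖g x‖ ^ 2 := fun x hx =>
    mul_nonneg (Real.rpow_nonneg (hpos x (subset_closure hx)).le _) (by positivity)
  have hB0 : ∀ x ∈ Ω, 0 ≤ b x * u x ^ (q - p) := fun x hx =>
    mul_nonneg (hb_nonneg x (subset_closure hx))
      (Real.rpow_nonneg (hpos x (subset_closure hx)).le _)
  have hsum : (1 - p) * (∫ x in Ω, u x ^ (-p) * ‖g x‖ ^ 2) -
      (lam * (∫ x in Ω, b x * u x ^ (q - p)) + ∫ x in Ω, a x) = 0 := by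
    have hBi : IntegrableOn (fun x => lam * (b x * u x ^ (q - p))) Ω := (hi hBc).const_mul _
    have hDi : IntegrableOn (fun x => (1 - p) * (u x ^ (-p) * ‖g x‖ ^ 2)) Ω :=
      (hi hDc).const_mul _
    have hBa : IntegrableOn (fun x => lam * (b x * u x ^ (q - p)) + a x) Ω := hBi.add (hi ha)
    rw [← hint, ← integral_const_mul, ← integral_const_mul, ← integral_add hBi (hi ha),
      ← integral_sub hDi hBa]
    refine setIntegral_congr_fun hm fun x hx => ?_
    have hux := hpos x (subset_closure hx)
    have h1 : deriv (fun s : ℝ => s ^ (1 - p)) (u x) = (1 - p) * u x ^ (-p) := by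
      rw [Real.deriv_rpow_const]
      ring_nf
    have h2 : u x ^ (q - p) = u x ^ (1 - p) * u x ^ (q - 1) := by
      rw [← Real.rpow_add hux]
      ring_nf
    have h3 : u x ^ (1 - p) * u x ^ (p - 1) = 1 := by
      rw [← Real.rpow_add hux, show 1 - p + (p - 1) = 0 by ring, Real.rpow_zero]
    simp only [h1, h2]
    linear_combination a x * h3
  have hDi := setIntegral_nonneg (μ := volume) hm hD0
  have hBi := setIntegral_nonneg (μ := volume) hm hB0
  have hlB := mul_nonneg hlam hBi
  have hD : ∫ x in Ω, u x ^ (-p) * ‖g x‖ ^ 2 = 0 := by nlinarith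
  have hgrad : ∀ x ∈ Ω, ∇ u x = 0 := fun x hx => by
    have := eqOn_zero_of_setIntegral_eq_zero hΩ.isOpen (hDc.mono subset_closure) hD0 (hi hDc) hD
      x hx
    rw [mul_eq_zero, or_iff_right (Real.rpow_pos_of_pos (hpos x (subset_closure hx)) _).ne'] at this
    rw [← hg hx, ← norm_eq_zero]
    exact pow_eq_zero_iff two_ne_zero |>.1 this
  rcases hlam.eq_or_lt with rfl | hlam
  · obtain ⟨x, hx, hne⟩ := exists_mem_ne_zero_of_closure ha ha_ne
    obtain ⟨θ, -, -, hreg⟩ := hu.regular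
    have hlap : Laplacian.laplacian u x = 0 := by
      rw [← divergence_gradient hΩ.isOpen hreg.contDiffOn hx,
        divergence_congr (EqOn.eventuallyEq_of_mem (g := fun _ => 0) hgrad
          (hΩ.isOpen.mem_nhds hx))]
      simp [divergence]
    have heq := hu.equation x hx
    rw [hlap] at heq
    have hux := Real.rpow_pos_of_pos (hpos x (subset_closure hx)) (p - 1)
    have : a x * u x ^ (p - 1) = 0 := by linarith
    exact (mul_ne_zero hne hux.ne') this
  · obtain ⟨x, hx, hne⟩ := exists_mem_ne_zero_of_closure hb hb_ne
    have hB : ∫ x in Ω, b x * u x ^ (q - p) = 0 := by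
      have : lam * ∫ x in Ω, b x * u x ^ (q - p) = 0 := by
        rw [hD, mul_zero] at hsum
        linarith
      exact (mul_eq_zero.1 this).resolve_left hlam.ne'
    have := eqOn_zero_of_setIntegral_eq_zero hΩ.isOpen (hBc.mono subset_closure) hB0 (hi hBc) hB
      x hx
    exact mul_ne_zero hne (Real.rpow_pos_of_pos (hpos x (subset_closure hx)) _).ne' this

/-- The Poincaré inequality with weight for Bochner integrals. -/
theorem IsSmoothBoundedDomain.exists_poincare (hΩ : IsSmoothBoundedDomain Ω)
    (hb : ContinuousOn b (closure Ω)) (hb_ne : ∃ x ∈ closure Ω, b x ≠ 0)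
    (hb_nonneg : ∀ x ∈ closure Ω, 0 ≤ b x) :
    ∃ C : ℝ, 0 ≤ C ∧ ∀ (u : EuclideanSpace ℝ (Fin N) → ℝ)
      (g : EuclideanSpace ℝ (Fin N) → EuclideanSpace ℝ (Fin N)), ContDiffOn ℝ 1 u Ω →
      ContinuousOn u (closure Ω) → ContinuousOn g (closure Ω) → EqOn g (∇ u) Ω →
      ∫ x in Ω, u x ^ 2 ≤ C * ((∫ x in Ω, ‖g x‖ ^ 2) + ∫ x in Ω, b x * u x ^ 2) := by
  obtain ⟨C, hC⟩ := hΩ.massControlled hb hb_ne hb_nonneg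
  refine ⟨C, C.coe_nonneg, fun u g hu huc hgc hg => ?_⟩
  have hK : IsCompact (closure Ω) := hΩ.isBounded.isCompact_closure
  have hm := hΩ.isOpen.measurableSet
  have hi : ∀ {f : EuclideanSpace ℝ (Fin N) → ℝ}, ContinuousOn f (closure Ω) →
      IntegrableOn f Ω := fun hf => (hf.integrableOn_compact hK).mono_set subset_closure
  have hB0 : ∀ x ∈ Ω, 0 ≤ b x * u x ^ 2 := fun x hx =>
    mul_nonneg (hb_nonneg x (subset_closure hx)) (sq_nonneg _)
  have hUi : IntegrableOn (fun x => u x ^ 2) Ω := hi (huc.pow 2)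
  have hGi : IntegrableOn (fun x => ‖g x‖ ^ 2) Ω := hi (hgc.norm.pow 2)
  have hBi : IntegrableOn (fun x => b x * u x ^ 2) Ω := hi (hb.mul (huc.pow 2))
  have h := hC u hu
  have hgn : ∫⁻ z in Ω, ENNReal.ofReal (‖fderiv ℝ u z‖ ^ 2) =
      ∫⁻ z in Ω, ENNReal.ofReal (‖g z‖ ^ 2) := by
    refine setLIntegral_congr_fun hm fun z hz => ?_
    simp only [hg hz, ← toDual_gradient, LinearIsometryEquiv.norm_map]
  rw [hgn, ← ofReal_integral_eq_lintegral_ofReal hUi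
      (Eventually.of_forall fun x => sq_nonneg _),
    ← ofReal_integral_eq_lintegral_ofReal hGi
      (Eventually.of_forall fun x => sq_nonneg _),
    ← ofReal_integral_eq_lintegral_ofReal hBi
      ((ae_restrict_mem hm).mono fun x hx => hB0 x hx),
    ← ENNReal.ofReal_add (integral_nonneg fun x => sq_nonneg _) (setIntegral_nonneg hm hB0),
    ← ENNReal.ofReal_coe_nnreal, ← ENNReal.ofReal_mul C.coe_nonneg] at h
  exact (ENNReal.ofReal_le_ofReal_iff (mul_nonneg C.coe_nonneg
    (add_nonneg (integral_nonneg fun x => sq_nonneg _) (setIntegral_nonneg hm hB0)))).1 h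

/-- The energy identity for a solution that is bounded by `δ ≤ 1`. -/
theorem IsNonnegSolution.energy_le (hΩ : IsSmoothBoundedDomain Ω) (hq1 : 1 < q) (hq2 : q < 2)
    (hp : 2 < p) (ha : ContinuousOn a (closure Ω)) (hb : ContinuousOn b (closure Ω))
    (hb_nonneg : ∀ x ∈ closure Ω, 0 ≤ b x) {A Lam δ : ℝ} (hA : ∀ x ∈ closure Ω, a x ≤ A)
    (hA0 : 0 ≤ A) (hLam : 0 < Lam) (hlam : lam ≤ -Lam) (hδ1 : δ ≤ 1)
    (hu : IsNonnegSolution Ω a b p q lam u) (huδ : ∀ x ∈ closure Ω, u x ≤ δ) :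
    ContinuousOn u (closure Ω) ∧ ∃ g : EuclideanSpace ℝ (Fin N) → EuclideanSpace ℝ (Fin N),
      ContinuousOn g (closure Ω) ∧ EqOn g (∇ u) Ω ∧
      (∫ x in Ω, ‖g x‖ ^ 2) + Lam * (∫ x in Ω, b x * u x ^ 2) ≤
        A * δ ^ (p - 2) * ∫ x in Ω, u x ^ 2 := by
  obtain ⟨huc, g, hgc, hg, hint⟩ :=
    hu.integral_energy_eq_zero hΩ hp hq1 ha hb isOpen_univ (φ := fun s => s) contDiffOn_id
      fun x _ => mem_univ (u x)
  refine ⟨huc, g, hgc, hg, ?_⟩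
  have hK : IsCompact (closure Ω) := hΩ.isBounded.isCompact_closure
  have hm := hΩ.isOpen.measurableSet
  have hi : ∀ {f : EuclideanSpace ℝ (Fin N) → ℝ}, ContinuousOn f (closure Ω) →
      IntegrableOn f Ω := fun hf => (hf.integrableOn_compact hK).mono_set subset_closure
  have h1 : ContinuousOn (fun x => u x ^ (q - 1)) (closure Ω) :=
    huc.rpow_const fun x _ => Or.inr (by linarith)
  have h2 : ContinuousOn (fun x => u x ^ (p - 1)) (closure Ω) :=
    huc.rpow_const fun x _ => Or.inr (by linarith)
  have hGi : IntegrableOn (fun x => ‖g x‖ ^ 2) Ω := hi (hgc.norm.pow 2)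
  have hBi : IntegrableOn (fun x => Lam * (b x * u x ^ 2)) Ω :=
    (hi (hb.mul (huc.pow 2))).const_mul Lam
  have hGB : IntegrableOn (fun x => ‖g x‖ ^ 2 + Lam * (b x * u x ^ 2)) Ω := hGi.add hBi
  have hUi : IntegrableOn (fun x => A * δ ^ (p - 2) * u x ^ 2) Ω :=
    (hi (huc.pow 2)).const_mul (A * δ ^ (p - 2))
  have hFi : IntegrableOn (fun x => deriv (fun s : ℝ => s) (u x) * ‖g x‖ ^ 2 -
      u x * (lam * b x * u x ^ (q - 1) + a x * u x ^ (p - 1))) Ω := by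
    simp only [deriv_id'', one_mul]
    exact hi ((hgc.norm.pow 2).sub (huc.mul (((continuousOn_const.mul hb).mul h1).add (ha.mul h2))))
  rw [← integral_const_mul, ← integral_const_mul, ← integral_add hGi hBi, ← sub_nonpos,
    ← integral_sub hGB hUi, ← hint]
  refine setIntegral_mono_on (hGB.sub hUi) hFi hm fun x hx => ?_
  have hxc := subset_closure hx
  have hb0 := hb_nonneg x hxc
  simp only [deriv_id'', one_mul]
  rcases (hu.nonneg x hxc).eq_or_lt with h0 | hpos
  · simp [← h0]
  -- This is where `u ≤ 1` and `q < 2` enter: the sublinear absorption term dominates the quadratic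
  -- weight needed for Poincaré.
  · have hq' : u x ^ 2 ≤ u x * u x ^ (q - 1) := by
      have : u x ≤ u x ^ (q - 1) := by
        conv_lhs => rw [← Real.rpow_one (u x)]
        exact Real.rpow_le_rpow_of_exponent_ge hpos ((huδ x hxc).trans hδ1) (by linarith)
      nlinarith
    have hp' : u x * u x ^ (p - 1) ≤ δ ^ (p - 2) * u x ^ 2 := by
      have h3 : u x ^ (p - 1) = u x ^ (p - 2) * u x := by
        rw [← Real.rpow_add_one hpos.ne']
        ring_nf
      have h4 : u x ^ (p - 2) ≤ δ ^ (p - 2) :=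
        Real.rpow_le_rpow hpos.le (huδ x hxc) (by linarith)
      rw [h3]
      nlinarith [mul_le_mul_of_nonneg_right h4 (sq_nonneg (u x))]
    have h5 : Lam * (b x * u x ^ 2) ≤ -lam * (b x * (u x * u x ^ (q - 1))) :=
      mul_le_mul (by linarith) (mul_le_mul_of_nonneg_left hq' hb0)
        (mul_nonneg hb0 (sq_nonneg _)) (by linarith)
    have h6 : a x * (u x * u x ^ (p - 1)) ≤ A * (δ ^ (p - 2) * u x ^ 2) :=
      mul_le_mul (hA x hxc) hp' (mul_nonneg hpos.le (Real.rpow_nonneg hpos.le _)) hA0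
    nlinarith

/-- If `max u ≤ δ`, the energy estimate and Poincaré combine to `∫ u² ≤ κ δ^(p-2) ∫ u²` with a
factor below `1`, contradicting `∫ u² > 0`. Neither `κ` nor `δ` depends on `lam` or `u`. -/
theorem exists_lower_bound (hΩ : IsSmoothBoundedDomain Ω) (hq1 : 1 < q) (hq2 : q < 2)
    (hp : 2 < p) (ha : ContinuousOn a (closure Ω)) (hb : ContinuousOn b (closure Ω))
    (hb_ne : ∃ x ∈ closure Ω, b x ≠ 0) (hb_nonneg : ∀ x ∈ closure Ω, 0 ≤ b x) {Lam : ℝ}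
    (hLam : 0 < Lam) :
    ∃ δ : ℝ, 0 < δ ∧ ∀ lam : ℝ, lam ≤ -Lam → ∀ u, IsNontrivialNonnegSolution Ω a b p q lam u →
      ∃ x ∈ closure Ω, IsMaxOn u (closure Ω) x ∧ δ < u x := by
  have hK : IsCompact (closure Ω) := hΩ.isBounded.isCompact_closure
  obtain ⟨A, hA0, hA⟩ : ∃ A : ℝ, 0 < A ∧ ∀ x ∈ closure Ω, a x ≤ A := by
    obtain ⟨A, hA⟩ := hK.exists_bound_of_continuousOn ha
    exact ⟨max A 1, by positivity, fun x hx =>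
      (Real.le_norm_self _).trans ((hA x hx).trans (le_max_left _ _))⟩
  obtain ⟨C, hC0, hC⟩ := hΩ.exists_poincare hb hb_ne hb_nonneg
  -- The factor `1 + Lam⁻¹` comes from `D + B ≤ (1 + Lam⁻¹) (D + Lam B)`; `C + 1` replaces `C` to
  -- make `κ` positive.
  set κ := (C + 1) * (1 + Lam⁻¹) * A with hκ
  have hκ0 : 0 < κ := by positivity
  obtain ⟨δ, hδ0, hδ1, hδ⟩ : ∃ δ : ℝ, 0 < δ ∧ δ ≤ 1 ∧ κ * δ ^ (p - 2) < 1 := by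
    have hlim : Tendsto (fun δ : ℝ => κ * δ ^ (p - 2)) (𝓝[>] 0) (𝓝 0) := by
      have h1 : ContinuousAt (fun δ : ℝ => κ * δ ^ (p - 2)) 0 :=
        continuousAt_const.mul (Real.continuousAt_rpow_const 0 (p - 2) (Or.inr (by linarith)))
      have h2 := h1.tendsto.mono_left (nhdsWithin_le_nhds (s := Ioi 0))
      simpa [Real.zero_rpow (by linarith : p - 2 ≠ 0)] using h2
    have h3 : ∀ᶠ δ : ℝ in 𝓝[>] 0, δ < 1 := nhdsWithin_le_nhds (gt_mem_nhds one_pos)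
    obtain ⟨δ, hδ, hδ1, hδ0⟩ :=
      ((hlim.eventually (gt_mem_nhds one_pos)).and (h3.and self_mem_nhdsWithin)).exists
    exact ⟨δ, hδ0, hδ1.le, hδ⟩
  refine ⟨δ, hδ0, fun lam hlam u ⟨hu, hne⟩ => ?_⟩
  obtain ⟨θ, -, -, hreg⟩ := hu.regular
  have huc := hreg.continuousOn
  obtain ⟨x, hx, hmax⟩ := hK.exists_isMaxOn hΩ.isConnected.nonempty.closure huc
  refine ⟨x, hx, hmax, ?_⟩
  by_contra! hle
  obtain ⟨-, g, hgc, hg, henergy⟩ := hu.energy_le hΩ hq1 hq2 hp ha hb hb_nonneg hA hA0.le hLam hlam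
    hδ1 fun y hy => (hmax hy).trans hle
  have hP := hC u g (hreg.contDiffOn.of_le (by norm_num)) huc hgc hg
  have hi : ∀ {f : EuclideanSpace ℝ (Fin N) → ℝ}, ContinuousOn f (closure Ω) →
      IntegrableOn f Ω := fun hf => (hf.integrableOn_compact hK).mono_set subset_closure
  have hD0 : 0 ≤ ∫ x in Ω, ‖g x‖ ^ 2 := integral_nonneg fun x => sq_nonneg _
  have hB0 : 0 ≤ ∫ x in Ω, b x * u x ^ 2 := setIntegral_nonneg hΩ.isOpen.measurableSet
    fun x hx => mul_nonneg (hb_nonneg x (subset_closure hx)) (sq_nonneg _)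
  have hI0 : 0 < ∫ x in Ω, u x ^ 2 := by
    refine lt_of_le_of_ne (integral_nonneg fun x => sq_nonneg _) fun h => ?_
    obtain ⟨y, hy, hyne⟩ := exists_mem_ne_zero_of_closure huc hne
    exact hyne (pow_eq_zero_iff two_ne_zero |>.1 (eqOn_zero_of_setIntegral_eq_zero hΩ.isOpen
      ((huc.pow 2).mono subset_closure) (fun x _ => sq_nonneg _) (hi (huc.pow 2)) h.symm y hy))
  generalize (∫ x in Ω, ‖g x‖ ^ 2) = D at *
  generalize (∫ x in Ω, b x * u x ^ 2) = B at *
  generalize (∫ x in Ω, u x ^ 2) = I at *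
  have hDB : D + B ≤ (1 + Lam⁻¹) * (D + Lam * B) := by
    have : (1 + Lam⁻¹) * (D + Lam * B) = D + B + (Lam * B + Lam⁻¹ * D) := by
      field_simp
      ring
    rw [this]
    have : 0 ≤ Lam * B + Lam⁻¹ * D := by positivity
    linarith
  have : I ≤ κ * δ ^ (p - 2) * I :=
    calc I ≤ C * (D + B) := hP
      _ ≤ (C + 1) * ((1 + Lam⁻¹) * (A * δ ^ (p - 2) * I)) := by
        refine mul_le_mul (by linarith) (hDB.trans ?_) (by positivity) (by linarith)
        exact mul_le_mul_of_nonneg_left henergy (by positivity)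
      _ = κ * δ ^ (p - 2) * I := by rw [hκ]; ring
  nlinarith

end Solutions

theorem proposition2p1 (N : ℕ) (hN : 2 ≤ N)
    (Ω : Set (EuclideanSpace ℝ (Fin N))) (hΩ : IsSmoothBoundedDomain Ω)
    (p q : ℝ) (hq1 : 1 < q) (hq2 : q < 2) (hp : 2 < p)
    (α : ℝ≥0) (hα0 : 0 < α) (hα1 : α < 1)
    (a b : EuclideanSpace ℝ (Fin N) → ℝ)
    (ha : MemHolderClosure Ω α a) (hb : MemHolderClosure Ω α b)
    (ha_ne : ∃ x ∈ closure Ω, a x ≠ 0) (hb_ne : ∃ x ∈ closure Ω, b x ≠ 0)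
    (hb_nonneg : ∀ x ∈ closure Ω, 0 ≤ b x)
    (ha_int : 0 ≤ ∫ x in Ω, a x) :
    (∀ lam : ℝ, 0 ≤ lam → ¬ ∃ u, IsPositiveSolution Ω a b p q lam u) ∧
    ((2 < N → p ≤ 2 * (N : ℝ) / ((N : ℝ) - 2)) →
      ∀ Lam : ℝ, 0 < Lam → ∃ δ₀ : ℝ, 0 < δ₀ ∧
        ∀ lam : ℝ, lam ≤ -Lam → ∀ u, IsNontrivialNonnegSolution Ω a b p q lam u →
          ∃ x ∈ closure Ω, IsMaxOn u (closure Ω) x ∧ δ₀ < u x) := by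
  have hac := ha.continuousOn hα0
  have hbc := hb.continuousOn hα0
  exact ⟨fun lam hlam ⟨u, hu⟩ => not_isPositiveSolution hΩ hq1 hp hac hbc ha_ne hb_ne hb_nonneg
      ha_int hlam hu,
    fun _ Lam hLam => exists_lower_bound hΩ hq1 hq2 hp hac hbc hb_ne hb_nonneg hLam⟩
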